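/- All spaces below are second countable compact Hausdorff spaces with their Borel $\sigma$-algebras $\mathfrak A_{(\cdot)}$; $X_1X_2$ means $X_1\times X_2$, etc. **Channels.** An information channel $X\to A$ is a family $(p(\cdot|x))_{x\in X}$ of Borel probability measures on $A$ with $x\mapsto p(\alpha|x)$ Borel for every $\alpha\in\mathfrak A_A$. A quantum probability measure (QPM) on $A$ over a Hilbert space $H$ is a map $E:\mathfrak A_A\to\mathcal B(H)^+$ with $E(A)=I$ that is countably additive in the weak* topology. An operator-valued channel $E:X\to(A;H)$ is a family $(E(\cdot|x))_{x\in X}$ of QPMs such that $x\mapsto\langle E(\alpha|x)\xi,\eta\rangle$ is Borel for all $\alpha\in\mathfrak A_A$ and $\xi,\eta\in H$. **Correlations.** A measurable no-signalling correlation over $(X,Y,A,B)$ is an information channel $p:X\times Y\to A\times B$ such that $p(\alpha\times B|x,y)$ does not depend on $y$ and $p(A\times\beta|x,y)$ does not depend on $x$, for all $\alpha\in\mathfrak A_A$, $\beta\in\mathfrak A_B$. Let $\mathcal C_{\rm ns}(X,Y,A,B)$ be the set of these, and let $\mathcal C_{\rm loc},\mathcal C_{\rm qs},\mathcal C_{\rm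 qc}\subseteq\mathcal C_{\rm ns}$ be the sets of those $p$ that are, respectively, * local: $p(\cdot|x,y)=\sum_{i=1}^n\lambda_i\,p^{(1)}_i(\cdot|x)\otimes p^{(2)}_i(\cdot|y)$ for some $n\in\mathbb N$, channels $p_i^{(1)}:X\to A$ and $p_i^{(2)}:Y\to B$, and $\lambda_i\ge0$ with $\sum_i\lambda_i=1$; * quantum spatial: $p(\cdot|x,y)=\langle (E\otimes F)(\cdot|x,y)\xi,\xi\rangle$ for some Hilbert spaces $H,K$, operator-valued channels $E:X\to(A;H)$ and $F:Y\to(B;K)$, and a unit vector $\xi\in H\otimes K$, where $(E\otimes F)(\cdot|x,y)$ is the QPM on $A\times B$ with $(E\otimes F)(\alpha\times\beta|x,y)=E(\alpha|x)\otimes F(\beta|y)$; * quantum commuting: $p(\cdot|x,y)=\langle (E\cdot F)(\cdot|x,y)\xi,\xi\rangle$ for some Hilbert space $H$, operator-valued channels $E:X\to(A;H)$ and $F:Y\to(B;H)$ with commuting ranges, and a unit vector $\xi\in H$, where $(E\cdot F)(\cdot|x,y)$ is the QPM on $A\times B$ with $(E\cdot F)(\alpha\times\beta|x,y)=E(\alpha|x)F(\beta|y)$.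 **Games.** Let $T_X,T_Y$ be homeomorphisms of $X$ and $Y$ (for instance the identities). A measurable game over $(X,Y,A,B)$ is a pair $(\kappa,\pi)$ of a set $\kappa\in\mathfrak A_X\otimes\mathfrak A_Y\otimes\mathfrak A_A\otimes\mathfrak A_B$ and a $T_X\times T_Y$-invariant Borel probability measure $\pi$ on $X\times Y$. For ${\rm t}\in\{{\rm loc},{\rm qs},{\rm qc},{\rm ns}\}$ its ${\rm t}$-value is $$\omega_{\rm t}(\kappa,\pi)=\sup_{p\in\mathcal C_{\rm t}(X,Y,A,B)}\int_{X\times Y}p\big(\{(a,b):(x,y,a,b)\in\kappa\}\,\big|\,x,y\big)\,d\pi(x,y)$$ (with $\sup\emptyset=0$). For games $(\kappa_i,\pi_i)$ over $(X_i,Y_i,A_i,B_i)$, $i=1,2$, put $$\kappa_1\dot\times\kappa_2=\{(x_1x_2,y_1y_2,a_1a_2,b_1b_2):(x_i,y_i,a_i,b_i)\in\kappa_i,\ i=1,2\},$$ and let $\pi_1\dot\times\pi_2$ be the Borel probability measure on $X_1X_2\times Y_1Y_2$ with $(\pi_1\dot\times\pi_2)(\alpha_1\times\alpha_2\times\beta_1\times\beta_2)=\pi_1(\alpha_1\times\beta_1)\,\pi_2(\alpha_2\times\beta_2)$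 for all $\alpha_i\in\mathfrak A_{X_i}$, $\beta_i\in\mathfrak A_{Y_i}$. The pair $(\kappa_1\dot\times\kappa_2,\pi_1\dot\times\pi_2)$ is a measurable game over $(X_1X_2,Y_1Y_2,A_1A_2,B_1B_2)$ with respect to the product homeomorphisms. **Proposition 6.3.** Let $(\kappa_i,\pi_i)$ be a measurable game over $(X_i,Y_i,A_i,B_i)$, $i=1,2$, and let ${\rm t}\in\{{\rm loc},{\rm qs},{\rm qc},{\rm ns}\}$. Then $$\omega_{\rm t}(\kappa_1\dot\times\kappa_2,\pi_1\dot\times\pi_2)\ \ge\ \omega_{\rm t}(\kappa_1,\pi_1)\,\omega_{\rm t}(\kappa_2,\pi_2).$$ Furthermore, if $A_2$ and $B_2$ are non-empty and $\kappa_2=X_2Y_2\times A_2B_2$, then $$\omega_{\rm t}(\kappa_1\dot\times\kappa_2,\pi_1\dot\times\pi_2)=\omega_{\rm t}(\kappa_1,\pi_1).$$ -/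

import Mathlib

open MeasureTheory ProbabilityTheory
open scoped ENNReal NNReal TensorProduct

universe w

namespace MeasGame

noncomputable section

/-! ### Quantum probability measures and operator-valued information channels -/

/-- A quantum probability measure on `A` with values in `B(H)`. Countable additivity is required
in the weak operator topology; for the increasing, norm-bounded partial sums of positive operators
occurring here this is the same as weak* convergence. Only the values on measurable sets matter. -/
structure QPM (A : Type*) [MeasurableSpace A] (H : Type*) [NormedAddCommGroup H]
    [InnerProductSpace ℂ H] where
  toFun : Set A → H →L[ℂ] H
  isPositive : ∀ α, MeasurableSet α → (toFun α).IsPositive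
  apply_univ : toFun Set.univ = ContinuousLinearMap.id ℂ H
  hasSum_iUnion : ∀ s : ℕ → Set A, (∀ i, MeasurableSet (s i)) →
    (∀ i j, i ≠ j → Disjoint (s i) (s j)) →
    ∀ ξ η : H, HasSum (fun i => inner ℂ η (toFun (s i) ξ)) (inner ℂ η (toFun (⋃ i, s i) ξ))

/-- An operator-valued information channel from `X` to `A` with values in `B(H)`. -/
structure OpChannel (X A : Type*) [MeasurableSpace X] [MeasurableSpace A] (H : Type*)
    [NormedAddCommGroup H] [InnerProductSpace ℂ H] where
  qpm : X → QPM A H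
  measurable : ∀ α, MeasurableSet α → ∀ ξ η : H,
    Measurable fun x => (inner ℂ η ((qpm x).toFun α ξ) : ℂ)

/-- The Hilbert space tensor product: the completion of the algebraic one. -/
abbrev HilbertTensor (H K : Type*) [NormedAddCommGroup H] [InnerProductSpace ℂ H]
    [NormedAddCommGroup K] [InnerProductSpace ℂ K] :=
  UniformSpace.Completion (H ⊗[ℂ] K)

/-- The bounded operator `S ⊗ T` on the Hilbert space tensor product. -/
def tensorOp {H K : Type*} [NormedAddCommGroup H] [InnerProductSpace ℂ H]
    [NormedAddCommGroup K] [InnerProductSpace ℂ K] (S : H →L[ℂ] H) (T : K →L[ℂ] K) :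
    HilbertTensor H K →L[ℂ] HilbertTensor H K :=
  (TensorProduct.mapL S T).completion

section Product

variable {X Y A B : Type*} [MeasurableSpace X] [MeasurableSpace Y] [MeasurableSpace A]
  [MeasurableSpace B]

/-- The channels `E` and `F` have commuting ranges. -/
def CommutingRanges {H : Type*} [NormedAddCommGroup H] [InnerProductSpace ℂ H]
    (E : OpChannel X A H) (F : OpChannel Y B H) : Prop :=
  ∀ x y α β, MeasurableSet α → MeasurableSet β →
    Commute ((E.qpm x).toFun α) ((F.qpm y).toFun β)

/-- `G` is the family of product quantum probability measures `(E · F)(· | x, y)`. -/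
def IsCommutingProduct {H : Type*} [NormedAddCommGroup H] [InnerProductSpace ℂ H]
    (E : OpChannel X A H) (F : OpChannel Y B H) (G : X × Y → QPM (A × B) H) : Prop :=
  ∀ x y α β, MeasurableSet α → MeasurableSet β →
    (G (x, y)).toFun (α ×ˢ β) = (E.qpm x).toFun α * (F.qpm y).toFun β

/-- `G` is the family of product quantum probability measures `(E ⊗ F)(· | x, y)`. -/
def IsTensorProduct {H K : Type*} [NormedAddCommGroup H] [InnerProductSpace ℂ H]
    [NormedAddCommGroup K] [InnerProductSpace ℂ K]
    (E : OpChannel X A H) (F : OpChannel Y B K)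
    (G : X × Y → QPM (A × B) (HilbertTensor H K)) : Prop :=
  ∀ x y α β, MeasurableSet α → MeasurableSet β →
    (G (x, y)).toFun (α ×ˢ β) = tensorOp ((E.qpm x).toFun α) ((F.qpm y).toFun β)

/-! ### No-signalling correlations and their types -/

/-- `p = p_{G, ξ}`, that is, `p(L | x, y) = ⟨G(L | x, y) ξ, ξ⟩`. -/
def IsVectorState {H : Type*} [NormedAddCommGroup H] [InnerProductSpace ℂ H]
    (p : Kernel (X × Y) (A × B)) (G : X × Y → QPM (A × B) H) (ξ : H) : Prop :=
  ∀ x y L, MeasurableSet L →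
    (((p (x, y)).real L : ℝ) : ℂ) = inner ℂ ξ ((G (x, y)).toFun L ξ)

/-- A measurable no-signalling correlation over `(X, Y, A, B)`: an information channel
(Markov kernel) from `X × Y` to `A × B` with well-defined marginal channels. -/
structure IsNS (p : Kernel (X × Y) (A × B)) : Prop where
  markov : IsMarkovKernel p
  left : ∀ x y y' (α : Set A), MeasurableSet α →
    p (x, y) (α ×ˢ Set.univ) = p (x, y') (α ×ˢ Set.univ)
  right : ∀ x x' y (β : Set B), MeasurableSet β →
    p (x, y) (Set.univ ×ˢ β) = p (x', y) (Set.univ ×ˢ β)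

/-- Finite convex combinations of products of information channels. -/
def IsLocal (p : Kernel (X × Y) (A × B)) : Prop :=
  ∃ (n : ℕ) (q : Fin n → Kernel X A) (r : Fin n → Kernel Y B) (c : Fin n → ℝ≥0),
    (∀ i, IsMarkovKernel (q i)) ∧ (∀ i, IsMarkovKernel (r i)) ∧ ∑ i, c i = 1 ∧
    ∀ x y, p (x, y) = ∑ i, c i • (q i x).prod (r i y)

/-- `p = p_{E ⊗ F, ξ}` for channels `E`, `F` on Hilbert spaces `H`, `K` and a unit vector
`ξ ∈ H ⊗ K`. -/
def IsQuantumSpatial (p : Kernel (X × Y) (A × B)) : Prop :=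
  ∃ (H K : Type w) (_ : NormedAddCommGroup H) (_ : InnerProductSpace ℂ H) (_ : CompleteSpace H)
    (_ : NormedAddCommGroup K) (_ : InnerProductSpace ℂ K) (_ : CompleteSpace K)
    (E : OpChannel X A H) (F : OpChannel Y B K)
    (G : X × Y → QPM (A × B) (HilbertTensor H K)) (ξ : HilbertTensor H K),
    IsTensorProduct E F G ∧ ‖ξ‖ = 1 ∧ IsVectorState p G ξ

/-- `p = p_{E · F, ξ}` for channels `E`, `F` with commuting ranges on a Hilbert space `H` and a
unit vector `ξ ∈ H`. -/
def IsQuantumCommuting (p : Kernel (X × Y) (A × B)) : Prop :=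
  ∃ (H : Type w) (_ : NormedAddCommGroup H) (_ : InnerProductSpace ℂ H) (_ : CompleteSpace H)
    (E : OpChannel X A H) (F : OpChannel Y B H) (G : X × Y → QPM (A × B) H) (ξ : H),
    CommutingRanges E F ∧ IsCommutingProduct E F G ∧ ‖ξ‖ = 1 ∧ IsVectorState p G ξ

end Product

/-- The four correlation types. -/
inductive CorrType
  | loc
  | qs
  | qc
  | ns

/-- The class `C_t` of measurable no-signalling correlations of type `t` over `(X, Y, A, B)`. -/
def corr (t : CorrType) (X Y A B : Type*) [MeasurableSpace X] [MeasurableSpace Y]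
    [MeasurableSpace A] [MeasurableSpace B] : Set (Kernel (X × Y) (A × B)) :=
  {p | IsNS p ∧
    match t with
    | .loc => IsLocal p
    | .qs => IsQuantumSpatial.{w} p
    | .qc => IsQuantumCommuting.{w} p
    | .ns => True}

/-! ### Measurable games and their values -/

/-- The `R`-value of `(κ, π)`, the supremum over `p ∈ R` of
`(π ⊗ p)(κ) = ∫ p({a | (x, a) ∈ κ} | x) dπ(x)`. -/
def resourceValue {X A : Type*} [MeasurableSpace X] [MeasurableSpace A]
    (R : Set (Kernel X A)) (κ : Set (X × A)) (π : Measure X) : ℝ≥0∞ :=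
  ⨆ p ∈ R, (π ⊗ₘ p) κ

/-- A measurable game over `(X, Y, A, B)`, where `X` and `Y` carry reference homeomorphisms
`TX` and `TY`: a measurable rule set `κ` and a `TX × TY`-invariant probability measure `π`. -/
structure MeasurableGame {X Y : Type*} [TopologicalSpace X] [MeasurableSpace X]
    [TopologicalSpace Y] [MeasurableSpace Y] (TX : X ≃ₜ X) (TY : Y ≃ₜ Y)
    (A B : Type*) [MeasurableSpace A] [MeasurableSpace B] where
  κ : Set ((X × Y) × (A × B))
  π : Measure (X × Y)
  measurableSet_κ : MeasurableSet κ
  isProbabilityMeasure : IsProbabilityMeasure π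
  invariant : π.map (Prod.map TX TY) = π

/-- The `t`-value of a measurable game. -/
def MeasurableGame.value {X Y : Type*} [TopologicalSpace X] [MeasurableSpace X]
    [TopologicalSpace Y] [MeasurableSpace Y] {TX : X ≃ₜ X} {TY : Y ≃ₜ Y}
    {A B : Type*} [MeasurableSpace A] [MeasurableSpace B] (t : CorrType)
    (G : MeasurableGame TX TY A B) : ℝ≥0∞ :=
  resourceValue (corr.{w} t X Y A B) G.κ G.π

/-- The rearrangement `((a, b), (a', b')) ↦ ((a, a'), (b, b'))`. -/
def shuffle {A B A' B' : Type*} (z : (A × B) × (A' × B')) : (A × A') × (B × B') :=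
  ((z.1.1, z.2.1), (z.1.2, z.2.2))

/-- The product `κ₁ ×̇ κ₂` of rule sets. -/
def dotSet {X₁ Y₁ A₁ B₁ X₂ Y₂ A₂ B₂ : Type*} (κ₁ : Set ((X₁ × Y₁) × (A₁ × B₁)))
    (κ₂ : Set ((X₂ × Y₂) × (A₂ × B₂))) :
    Set (((X₁ × X₂) × (Y₁ × Y₂)) × ((A₁ × A₂) × (B₁ × B₂))) :=
  {z | ((z.1.1.1, z.1.2.1), (z.2.1.1, z.2.2.1)) ∈ κ₁ ∧
    ((z.1.1.2, z.1.2.2), (z.2.1.2, z.2.2.2)) ∈ κ₂}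

/-- The product `π₁ ×̇ π₂`, the probability measure on `(X₁ × X₂) × (Y₁ × Y₂)` with
`(α₁ × α₂) × (β₁ × β₂) ↦ π₁(α₁ × β₁) π₂(α₂ × β₂)`. -/
def dotMeasure {X₁ Y₁ X₂ Y₂ : Type*} [MeasurableSpace X₁] [MeasurableSpace Y₁]
    [MeasurableSpace X₂] [MeasurableSpace Y₂] (π₁ : Measure (X₁ × Y₁))
    (π₂ : Measure (X₂ × Y₂)) : Measure ((X₁ × X₂) × (Y₁ × Y₂)) :=
  (π₁.prod π₂).map shuffle

lemma measurable_shuffle {A B A' B' : Type*} [MeasurableSpace A] [MeasurableSpace B]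
    [MeasurableSpace A'] [MeasurableSpace B'] :
    Measurable (shuffle : (A × B) × (A' × B') → (A × A') × (B × B')) := by
  unfold shuffle; fun_prop

/-- The product of two measurable games, `(κ₁ ×̇ κ₂, π₁ ×̇ π₂)`; the reference homeomorphisms
are the products of the given ones. -/
def MeasurableGame.dot {X₁ Y₁ X₂ Y₂ : Type*}
    [TopologicalSpace X₁] [MeasurableSpace X₁] [BorelSpace X₁]
    [TopologicalSpace Y₁] [MeasurableSpace Y₁] [BorelSpace Y₁]
    [TopologicalSpace X₂] [MeasurableSpace X₂] [BorelSpace X₂]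
    [TopologicalSpace Y₂] [MeasurableSpace Y₂] [BorelSpace Y₂]
    {TX₁ : X₁ ≃ₜ X₁} {TY₁ : Y₁ ≃ₜ Y₁} {TX₂ : X₂ ≃ₜ X₂} {TY₂ : Y₂ ≃ₜ Y₂}
    {A₁ B₁ A₂ B₂ : Type*} [MeasurableSpace A₁] [MeasurableSpace B₁]
    [MeasurableSpace A₂] [MeasurableSpace B₂]
    (G₁ : MeasurableGame TX₁ TY₁ A₁ B₁) (G₂ : MeasurableGame TX₂ TY₂ A₂ B₂) :
    MeasurableGame (TX₁.prodCongr TX₂) (TY₁.prodCongr TY₂) (A₁ × A₂) (B₁ × B₂) where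
  κ := dotSet G₁.κ G₂.κ
  π := dotMeasure G₁.π G₂.π
  measurableSet_κ := by
    have h₁ := G₁.measurableSet_κ
    have h₂ := G₂.measurableSet_κ
    exact (h₁.preimage (f := fun z : ((X₁ × X₂) × (Y₁ × Y₂)) × ((A₁ × A₂) × (B₁ × B₂)) =>
        ((z.1.1.1, z.1.2.1), (z.2.1.1, z.2.2.1))) (by fun_prop)).inter
      (h₂.preimage (f := fun z : ((X₁ × X₂) × (Y₁ × Y₂)) × ((A₁ × A₂) × (B₁ × B₂)) =>
        ((z.1.1.2, z.1.2.2), (z.2.1.2, z.2.2.2))) (by fun_prop))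
  isProbabilityMeasure := by
    have := G₁.isProbabilityMeasure
    have := G₂.isProbabilityMeasure
    exact Measure.isProbabilityMeasure_map measurable_shuffle.aemeasurable
  invariant := by
    have := G₁.isProbabilityMeasure
    have := G₂.isProbabilityMeasure
    have m₁ : Measurable (Prod.map TX₁ TY₁) := TX₁.measurable.prodMap TY₁.measurable
    have m₂ : Measurable (Prod.map TX₂ TY₂) := TX₂.measurable.prodMap TY₂.measurable
    have m₃ : Measurable (Prod.map (TX₁.prodCongr TX₂) (TY₁.prodCongr TY₂)) :=
      (TX₁.measurable.prodMap TX₂.measurable).prodMap (TY₁.measurable.prodMap TY₂.measurable)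
    have h : (G₁.π.prod G₂.π).map (Prod.map (Prod.map TX₁ TY₁) (Prod.map TX₂ TY₂))
        = G₁.π.prod G₂.π := by
      rw [← Measure.map_prod_map _ _ m₁ m₂, G₁.invariant, G₂.invariant]
    unfold dotMeasure
    rw [Measure.map_map m₃ measurable_shuffle]
    conv_rhs => rw [← h, Measure.map_map measurable_shuffle (m₁.prodMap m₂)]
    rfl

end

end MeasGame

/-! The inequality comes from playing the two games side by side. By Fubini the product strategy
`dotKernel p₁ p₂` wins the product game with the product of the winning probabilities, so it remains
to see that each class is stable under products (`dotKernel_mem_corr`). No-signalling holds because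
marginals multiply, and convex combinations of product channels multiply out.

The quantum classes need the tensor product of operator-valued channels (`tensorChannel`). On
algebraic tensors its matrix coefficients are finite sums of products of complex measures, hence
countably additive and determined by rectangles. Uniqueness makes them sesquilinear in the vectors.
Positivity passes from rectangles to countable disjoint unions of rectangles, and then to all sets
by approximation in a dominating measure. The resulting positive forms, normalized by the inner
product, are represented by operators on the completion (`exists_qpm_of_form`). Spatial correlations
then use the state obtained from `ξ₁ ⊗ ξ₂` by exchanging the middle factors (`exchange`); commuting
ones use `ξ₁ ⊗ ξ₂` itself.

For a trivial second game, any strategy for the product becomes one for the first game by fixing the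
second questions and forgetting the second answers, and its value is an average of such values.
Conversely a strategy for the first game extends by constant second answers. Both are local
processing, which preserves every class (`process_mem_corr`). -/

namespace MeasGame

open scoped ComplexOrder

/-! ### Countably additive complex set functions -/

section CountablyAdditive

variable {A B C D : Type*} [MeasurableSpace A] [MeasurableSpace B] [MeasurableSpace C]
  [MeasurableSpace D]

/-- `f` is countably additive on the measurable sets; its other values are irrelevant. -/
def IsCA (f : Set A → ℂ) : Prop :=
  ∀ s : ℕ → Set A, (∀ i, MeasurableSet (s i)) → (∀ i j, i ≠ j → Disjoint (s i) (s j)) →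
    HasSum (fun i => f (s i)) (f (⋃ i, s i))

namespace IsCA

variable {f g : Set A → ℂ}

/-- The constant sequence `∅` is disjoint, and a summable constant sequence in `ℂ` is zero. -/
lemma empty (hf : IsCA f) : f ∅ = 0 := by
  have h := hf (fun _ => ∅) (fun _ => MeasurableSet.empty) (fun _ _ _ => disjoint_bot_left)
  exact (summable_const_iff (β := ℕ) _).1 h.summable

lemma congr (hf : IsCA f) (h : ∀ L, MeasurableSet L → g L = f L) : IsCA g := by
  intro s hs hd
  rw [h _ (MeasurableSet.iUnion hs)]
  simpa only [h _ (hs _)] using hf s hs hd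

/-- The vector measure with the values of `f` on the measurable sets. -/
noncomputable def toComplexMeasure (hf : IsCA f) : ComplexMeasure A := by
  classical
  exact
  { measureOf' := fun L => if MeasurableSet L then f L else 0
    empty' := by simp [hf.empty]
    not_measurable' := fun L hL => if_neg hL
    m_iUnion' := fun s hs hd => by
      simp only [hs, MeasurableSet.iUnion hs, if_true]
      exact hf s hs fun i j hij => hd hij }

lemma toComplexMeasure_apply (hf : IsCA f) {L : Set A} (hL : MeasurableSet L) :
    hf.toComplexMeasure L = f L :=
  if_pos hL

lemma union (hf : IsCA f) {s t : Set A} (hs : MeasurableSet s) (ht : MeasurableSet t)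
    (h : Disjoint s t) : f (s ∪ t) = f s + f t := by
  rw [← hf.toComplexMeasure_apply hs, ← hf.toComplexMeasure_apply ht,
    ← hf.toComplexMeasure_apply (hs.union ht)]
  exact VectorMeasure.of_union h hs ht

lemma compl (hf : IsCA f) {s : Set A} (hs : MeasurableSet s) : f sᶜ = f Set.univ - f s := by
  rw [← Set.union_compl_self s, hf.union hs hs.compl disjoint_compl_right]
  ring

lemma add (hf : IsCA f) (hg : IsCA g) : IsCA (fun L => f L + g L) :=
  fun s hs hd => (hf s hs hd).add (hg s hs hd)

lemma const_mul (hf : IsCA f) (c : ℂ) : IsCA (fun L => c * f L) :=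
  fun s hs hd => (hf s hs hd).mul_left c

lemma zero : IsCA (fun _ : Set A => (0 : ℂ)) := fun _ _ _ => hasSum_zero

lemma sum {ι : Type*} (t : Finset ι) {F : ι → Set A → ℂ} (h : ∀ i ∈ t, IsCA (F i)) :
    IsCA (fun L => ∑ i ∈ t, F i L) :=
  fun s hs hd => hasSum_sum fun i hi => h i hi s hs hd

lemma measure (μ : Measure A) [IsFiniteMeasure μ] : IsCA (fun L => ((μ.real L : ℝ) : ℂ)) := by
  intro s hs hd
  rw [Complex.hasSum_ofReal]
  have := μ.toSignedMeasure.m_iUnion hs fun i j hij => hd i j hij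
  simpa only [Measure.toSignedMeasure_apply_measurable (hs _),
    Measure.toSignedMeasure_apply_measurable (MeasurableSet.iUnion hs)] using this

lemma prod_right {f : Set (A × B) → ℂ} (hf : IsCA f) {α : Set A} (hα : MeasurableSet α) :
    IsCA (fun β : Set B => f (α ×ˢ β)) := by
  intro s hs hd
  beta_reduce
  rw [Set.prod_iUnion]
  exact hf _ (fun i => hα.prod (hs i)) fun i j hij => Set.Disjoint.set_prod_right (hd i j hij) _ _

lemma prod_left {f : Set (A × B) → ℂ} (hf : IsCA f) {β : Set B} (hβ : MeasurableSet β) :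
    IsCA (fun α : Set A => f (α ×ˢ β)) := by
  intro s hs hd
  beta_reduce
  rw [Set.iUnion_prod_const]
  exact hf _ (fun i => (hs i).prod hβ) fun i j hij => Set.Disjoint.set_prod_left (hd i j hij) _ _

/-- A countably additive set function on a product is determined by its values on rectangles. -/
lemma ext_prod {f g : Set (A × B) → ℂ} (hf : IsCA f) (hg : IsCA g)
    (h : ∀ α β, MeasurableSet α → MeasurableSet β → f (α ×ˢ β) = g (α ×ˢ β))
    {L : Set (A × B)} (hL : MeasurableSet L) : f L = g L := by
  induction L, hL using MeasurableSpace.induction_on_inter generateFrom_prod.symm isPiSystem_prod with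
  | empty => rw [hf.empty, hg.empty]
  | basic t ht =>
    obtain ⟨α, hα, β, hβ, rfl⟩ := ht
    exact h α β hα hβ
  | compl t htm ih =>
    rw [hf.compl htm, hg.compl htm, ih, ← Set.univ_prod_univ, h _ _ .univ .univ]
  | iUnion s hd hs ih =>
    have h1 := hf s hs fun i j hij => hd hij
    have h2 := hg s hs fun i j hij => hd hij
    simp only [ih] at h1
    exact h1.unique h2

/-- A countably additive set function on a fourfold product is determined by its values on
rectangles. -/
lemma ext_prod_prod {f g : Set ((A × B) × (C × D)) → ℂ} (hf : IsCA f) (hg : IsCA g)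
    (h : ∀ (α : Set A) (β : Set B) (γ : Set C) (δ : Set D), MeasurableSet α → MeasurableSet β →
      MeasurableSet γ → MeasurableSet δ →
      f ((α ×ˢ β) ×ˢ (γ ×ˢ δ)) = g ((α ×ˢ β) ×ˢ (γ ×ˢ δ)))
    {L : Set ((A × B) × (C × D))} (hL : MeasurableSet L) : f L = g L := by
  refine hf.ext_prod hg (fun M N hM hN => ?_) hL
  refine (hf.prod_left hN).ext_prod (hg.prod_left hN) (fun α β hα hβ => ?_) hM
  exact (hf.prod_right (hα.prod hβ)).ext_prod (hg.prod_right (hα.prod hβ))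
    (fun γ δ hγ hδ => h α β γ δ hα hβ hγ hδ) hN

/-- A countably additive complex set function is a combination of finite measures. -/
lemma exists_measures (hf : IsCA f) : ∃ μ : Fin 4 → Measure A, (∀ i, IsFiniteMeasure (μ i)) ∧
    ∀ L, MeasurableSet L → f L = ∑ i : Fin 4, Complex.I ^ (i : ℕ) * (((μ i).real L : ℝ) : ℂ) := by
  have key : ∀ (s : SignedMeasure A) {L : Set A}, MeasurableSet L →
      s L = s.toJordanDecomposition.posPart.real L - s.toJordanDecomposition.negPart.real L := by
    intro s L hL
    conv_lhs => rw [← s.toSignedMeasure_toJordanDecomposition, JordanDecomposition.toSignedMeasure]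
    rw [sub_apply, Measure.toSignedMeasure_apply_measurable hL,
      Measure.toSignedMeasure_apply_measurable hL]
  set c := hf.toComplexMeasure
  -- The order re⁺, im⁺, re⁻, im⁻ matches the coefficients 1, i, -1, -i, the powers of i.
  refine ⟨![(ComplexMeasure.re c).toJordanDecomposition.posPart,
    (ComplexMeasure.im c).toJordanDecomposition.posPart,
    (ComplexMeasure.re c).toJordanDecomposition.negPart,
    (ComplexMeasure.im c).toJordanDecomposition.negPart], ?_, fun L hL => ?_⟩
  · intro i
    fin_cases i <;> simp <;> infer_instance
  · rw [← hf.toComplexMeasure_apply hL]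
    have h1 := key (ComplexMeasure.re c) hL
    have h2 := key (ComplexMeasure.im c) hL
    have h3 : (ComplexMeasure.re c) L = (c L).re := rfl
    have h4 : (ComplexMeasure.im c) L = (c L).im := rfl
    rw [h3] at h1
    rw [h4] at h2
    rw [← Complex.re_add_im (hf.toComplexMeasure L), h1, h2]
    simp only [Fin.sum_univ_four]
    simp [pow_succ]
    ring

/-- A countably additive complex set function is dominated by a finite measure. -/
lemma exists_dominating (hf : IsCA f) : ∃ μ : Measure A, IsFiniteMeasure μ ∧
    ∀ L, MeasurableSet L → ‖f L‖ ≤ μ.real L := by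
  obtain ⟨μ, hμ, h⟩ := hf.exists_measures
  refine ⟨∑ i, μ i, inferInstance, fun L hL => ?_⟩
  rw [h L hL, measureReal_def, Measure.finsetSum_apply,
    ENNReal.toReal_sum fun i _ => measure_ne_top _ _]
  refine (norm_sum_le _ _).trans (Finset.sum_le_sum fun i _ => ?_)
  simp [measureReal_def]

/-- The product of two countably additive complex set functions. -/
lemma exists_prod {g : Set B → ℂ} (hf : IsCA f) (hg : IsCA g) : ∃ h : Set (A × B) → ℂ, IsCA h ∧
    ∀ α β, MeasurableSet α → MeasurableSet β → h (α ×ˢ β) = f α * g β := by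
  obtain ⟨μ, hμ, hf'⟩ := hf.exists_measures
  obtain ⟨ν, hν, hg'⟩ := hg.exists_measures
  refine ⟨fun L => ∑ i : Fin 4, ∑ j : Fin 4, Complex.I ^ (i : ℕ) * Complex.I ^ (j : ℕ) *
    ((((μ i).prod (ν j)).real L : ℝ) : ℂ), ?_, fun α β hα hβ => ?_⟩
  · exact IsCA.sum _ fun i _ => IsCA.sum _ fun j _ => (IsCA.measure _).const_mul _
  · rw [hf' α hα, hg' β hβ, Finset.sum_mul_sum]
    refine Finset.sum_congr rfl fun i _ => Finset.sum_congr rfl fun j _ => ?_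
    rw [measureReal_prod_prod, Complex.ofReal_mul]
    ring

end IsCA

/-- The sets described by countable measurable partitions of the factors. -/
def gridSets (A B : Type*) [MeasurableSpace A] [MeasurableSpace B] : Set (Set (A × B)) :=
  {L | ∃ (φ : A → ℕ) (ψ : B → ℕ) (S : Set (ℕ × ℕ)), Measurable φ ∧ Measurable ψ ∧
    L = {z | (φ z.1, ψ z.2) ∈ S}}

lemma measurableSet_of_mem_gridSets {L : Set (A × B)} (hL : L ∈ gridSets A B) :
    MeasurableSet L := by
  obtain ⟨φ, ψ, S, hφ, hψ, rfl⟩ := hL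
  have : Measurable fun z : A × B => (φ z.1, ψ z.2) := by fun_prop
  exact this (MeasurableSet.of_discrete (s := S))

/-- For unions, pass to a common refinement of the partitions by pairing the labels. -/
lemma isSetAlgebra_gridSets : IsSetAlgebra (gridSets A B) where
  empty_mem := ⟨fun _ => 0, fun _ => 0, ∅, measurable_const, measurable_const, by simp⟩
  compl_mem := by
    rintro _ ⟨φ, ψ, S, hφ, hψ, rfl⟩
    exact ⟨φ, ψ, Sᶜ, hφ, hψ, rfl⟩
  union_mem := by
    rintro _ _ ⟨φ, ψ, S, hφ, hψ, rfl⟩ ⟨φ', ψ', S', hφ', hψ', rfl⟩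
    have hp : Measurable fun n : ℕ × ℕ => Nat.pair n.1 n.2 := measurable_of_countable _
    refine ⟨fun a => Nat.pair (φ a) (φ' a), fun b => Nat.pair (ψ b) (ψ' b),
      {n | (n.1.unpair.1, n.2.unpair.1) ∈ S ∨ (n.1.unpair.2, n.2.unpair.2) ∈ S'},
      hp.comp (hφ.prodMk hφ'), hp.comp (hψ.prodMk hψ'), ?_⟩
    ext z
    simp

lemma generateFrom_gridSets :
    (inferInstance : MeasurableSpace (A × B)) = MeasurableSpace.generateFrom (gridSets A B) := by
  classical
  refine le_antisymm ?_ (MeasurableSpace.generateFrom_le fun _ => measurableSet_of_mem_gridSets)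
  rw [← generateFrom_prod]
  refine MeasurableSpace.generateFrom_mono ?_
  rintro _ ⟨α, hα, β, hβ, rfl⟩
  refine ⟨fun a => if a ∈ α then 1 else 0, fun b => if b ∈ β then 1 else 0, {(1, 1)},
    Measurable.ite hα measurable_const measurable_const,
    Measurable.ite hβ measurable_const measurable_const, ?_⟩
  ext z
  simp

/-- Positivity of a countably additive set function can be tested on rectangles. -/
lemma IsCA.nonneg_of_prod {f : Set (A × B) → ℂ} (hf : IsCA f)
    (h : ∀ α β, MeasurableSet α → MeasurableSet β → 0 ≤ f (α ×ˢ β))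
    {L : Set (A × B)} (hL : MeasurableSet L) : 0 ≤ f L := by
  classical
  have grid : ∀ M ∈ gridSets A B, 0 ≤ f M := by
    rintro _ ⟨φ, ψ, S, hφ, hψ, rfl⟩
    -- Enumerate the cells by `Nat.unpair`, emptying those outside `S`: a grid set is a countable
    -- disjoint union of rectangles, so its value is a sum of nonnegative terms.
    set s : ℕ → Set (A × B) := fun n =>
      if n.unpair ∈ S then (φ ⁻¹' {n.unpair.1}) ×ˢ (ψ ⁻¹' {n.unpair.2}) else ∅ with hs
    have hmem : ∀ n z, z ∈ s n ↔ n.unpair ∈ S ∧ n.unpair = (φ z.1, ψ z.2) := by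
      intro n z
      by_cases hn : n.unpair ∈ S <;> simp [hs, hn, Prod.ext_iff, eq_comm]
    have hU : {z : A × B | (φ z.1, ψ z.2) ∈ S} = ⋃ n, s n := by
      ext z
      simp only [Set.mem_ofPred_eq, Set.mem_iUnion, hmem]
      constructor
      · intro hz
        exact ⟨Nat.pair (φ z.1) (ψ z.2), by simpa using hz, by simp⟩
      · rintro ⟨n, hn, h'⟩
        rwa [← h']
    rw [hU]
    have hsum := hf s (fun n => ?_) (fun i j hij => ?_)
    · refine hsum.nonneg fun n => ?_
      by_cases hn : n.unpair ∈ S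
      · simp only [hs, hn, if_true]
        exact h _ _ (hφ (measurableSet_singleton _)) (hψ (measurableSet_singleton _))
      · simp [hs, hn, hf.empty]
    · by_cases hn : n.unpair ∈ S
      · simp only [hs, hn, if_true]
        exact (hφ (measurableSet_singleton _)).prod (hψ (measurableSet_singleton _))
      · simp [hs, hn]
    · refine Set.disjoint_left.2 fun z hi hj => hij ?_
      rw [hmem] at hi hj
      have := hi.2.trans hj.2.symm
      simpa using congrArg (fun p : ℕ × ℕ => Nat.pair p.1 p.2) this
  -- The difference of the values of `f` at `L` and at a grid set `t` is at most the `μ`-measure of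
  -- their symmetric difference, which can be made small. Since the nonnegative numbers form a
  -- closed set, positivity passes to `L`.
  obtain ⟨μ, hμ, hdom⟩ := hf.exists_dominating
  have hdense := Measure.MeasureDense.of_generateFrom_isSetAlgebra_finite (μ := μ)
    isSetAlgebra_gridSets generateFrom_gridSets
  have hcl : f L ∈ closure {z : ℂ | 0 ≤ z} := by
    rw [Metric.mem_closure_iff]
    intro ε hε
    obtain ⟨t, ht, hlt⟩ := hdense.approx L hL (measure_ne_top _ _) ε hε
    have htm := measurableSet_of_mem_gridSets ht
    refine ⟨f t, grid t ht, ?_⟩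
    have e1 : f L = f (L ∩ t) + f (L \ t) := by
      rw [← hf.union (hL.inter htm) (hL.diff htm) Set.disjoint_sdiff_inter.symm,
        Set.inter_union_sdiff]
    have e2 : f t = f (L ∩ t) + f (t \ L) := by
      rw [Set.inter_comm, ← hf.union (htm.inter hL) (htm.diff hL) Set.disjoint_sdiff_inter.symm,
        Set.inter_union_sdiff]
    rw [dist_eq_norm, e1, e2, add_sub_add_left_eq_sub]
    calc ‖f (L \ t) - f (t \ L)‖ ≤ ‖f (L \ t)‖ + ‖f (t \ L)‖ := norm_sub_le _ _
      _ ≤ μ.real (L \ t) + μ.real (t \ L) :=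
        add_le_add (hdom _ (hL.diff htm)) (hdom _ (htm.diff hL))
      _ = μ.real (symmDiff L t) := by
        rw [Set.symmDiff_def, measureReal_union disjoint_sdiff_sdiff (htm.diff hL)]
      _ < ε := by
        rw [measureReal_def]
        exact (ENNReal.toReal_lt_toReal (measure_ne_top _ _) ENNReal.ofReal_ne_top).2 hlt
          |>.trans_eq (ENNReal.toReal_ofReal hε.le)
  rwa [(isClosed_Ici (a := (0 : ℂ))).closure_eq (s := {z : ℂ | 0 ≤ z})] at hcl

/-- Measurable dependence on a parameter can be tested on rectangles. -/
lemma IsCA.measurable_of_prod {X : Type*} [MeasurableSpace X] {f : X → Set (A × B) → ℂ}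
    (hf : ∀ x, IsCA (f x))
    (h : ∀ α β, MeasurableSet α → MeasurableSet β → Measurable fun x => f x (α ×ˢ β))
    {L : Set (A × B)} (hL : MeasurableSet L) : Measurable fun x => f x L := by
  induction L, hL using MeasurableSpace.induction_on_inter generateFrom_prod.symm isPiSystem_prod with
  | empty => simp only [(hf _).empty, measurable_const]
  | basic t ht =>
    obtain ⟨α, hα, β, hβ, rfl⟩ := ht
    exact h α β hα hβ
  | compl t htm ih =>
    simp only [(hf _).compl htm]
    refine Measurable.sub ?_ ih
    simpa only [Set.univ_prod_univ] using h _ _ MeasurableSet.univ MeasurableSet.univ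
  | iUnion s hd hs ih =>
    have h1 := fun x => (hf x s hs fun i j hij => hd hij).tendsto_sum_nat
    exact measurable_of_tendsto_metrizable
      (fun n => Finset.measurable_fun_sum _ fun i _ => ih i) (tendsto_pi_nhds.2 h1)

end CountablyAdditive

/-! ### Bilinear maps, forms and operators on completions -/

section Completion

open UniformSpace

variable {V W : Type*} [NormedAddCommGroup V] [InnerProductSpace ℂ V]
  [NormedAddCommGroup W] [InnerProductSpace ℂ W]

/-- The extension of a bounded bilinear or sesquilinear map to the completions. -/
noncomputable def extend₂ {σ : ℂ →+* ℂ} [RingHomIsometric σ] {Z : Type*} [NormedAddCommGroup Z]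
    [NormedSpace ℂ Z] [CompleteSpace Z] (b : V →SL[σ] W →L[ℂ] Z) :
    Completion V →SL[σ] Completion W →L[ℂ] Z :=
  b.fromCompletion.flip.fromCompletion.flip

lemma extend₂_coe {σ : ℂ →+* ℂ} [RingHomIsometric σ] {Z : Type*} [NormedAddCommGroup Z]
    [NormedSpace ℂ Z] [CompleteSpace Z] (b : V →SL[σ] W →L[ℂ] Z) (v : V) (u : W) :
    extend₂ b (v : Completion V) (u : Completion W) = b v u := by
  simp [extend₂]

lemma completion_op_ext {S T : Completion V →L[ℂ] Completion V}
    (h : ∀ v u : V, (inner ℂ (v : Completion V) (S u) : ℂ) = inner ℂ (v : Completion V) (T u)) :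
    S = T := by
  ext u
  refine ext_inner_left ℂ fun v => ?_
  induction v, u using Completion.induction_on₂ with
  | hp => exact isClosed_eq (by fun_prop) (by fun_prop)
  | ih v u => exact h v u

/-- A form with nonnegative diagonal is Hermitian. -/
lemma conj_form_of_nonneg (q : V →ₗ⋆[ℂ] V →ₗ[ℂ] ℂ) (hq : ∀ u, 0 ≤ q u u) (u v : V) :
    starRingEnd ℂ (q u v) = q v u := by
  have im0 : ∀ u, (q u u).im = 0 := fun u => (Complex.nonneg_iff.1 (hq u)).2.symm
  -- Reality of the diagonal at `u + v` gives the imaginary part of the identity, and at `u + i v`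
  -- the real part.
  have h1 := im0 (u + v)
  have h2 := im0 (u + Complex.I • v)
  simp only [map_add, LinearMap.add_apply, Complex.add_im, Complex.add_re, im0, map_smulₛₗ,
    LinearMap.smul_apply, smul_eq_mul, Complex.conj_I, RingHom.id_apply, Complex.mul_im,
    Complex.mul_re, Complex.neg_re, Complex.neg_im, Complex.I_re, Complex.I_im] at h1 h2
  apply Complex.ext
  · simp only [Complex.conj_re]
    linarith
  · simp only [Complex.conj_im]
    linarith

/-- A form with `0 ≤ q ≤ 1` is bounded by `1`. -/
lemma norm_form_le (q : V →ₗ⋆[ℂ] V →ₗ[ℂ] ℂ) (hq : ∀ u, 0 ≤ q u u)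
    (hq1 : ∀ u, (q u u).re ≤ ‖u‖ ^ 2) (v u : V) : ‖q v u‖ ≤ ‖v‖ * ‖u‖ := by
  -- The form may be degenerate, so Cauchy–Schwarz is taken for a pre-inner product; as a local term
  -- it leaves the norm of `V` untouched.
  let c : PreInnerProductSpace.Core ℂ V :=
    { inner := fun v u => q v u
      conj_inner_symm := fun v u => conj_form_of_nonneg q hq u v
      re_inner_nonneg := fun u => (Complex.nonneg_iff.1 (hq u)).1
      add_left := fun x y z => by simp
      smul_left := fun x y r => by simp }
  have h := @InnerProductSpace.Core.inner_mul_inner_self_le ℂ V _ _ _ c v u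
  change ‖q v u‖ * ‖q u v‖ ≤ (q v v).re * (q u u).re at h
  rw [← conj_form_of_nonneg q hq v u, RCLike.norm_conj] at h
  refine abs_le_of_sq_le_sq' ?_ (by positivity) |>.2
  calc ‖q v u‖ ^ 2 ≤ (q v v).re * (q u u).re := by rw [sq]; exact h
    _ ≤ ‖v‖ ^ 2 * ‖u‖ ^ 2 :=
      mul_le_mul (hq1 v) (hq1 u) (Complex.nonneg_iff.1 (hq u)).1 (by positivity)
    _ = (‖v‖ * ‖u‖) ^ 2 := by ring

/-- A form with `0 ≤ q ≤ 1` is represented by a positive contraction on the completion. -/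
lemma exists_op_of_form (q : V →ₗ⋆[ℂ] V →ₗ[ℂ] ℂ) (hq : ∀ u, 0 ≤ q u u)
    (hq1 : ∀ u, (q u u).re ≤ ‖u‖ ^ 2) :
    ∃ T : Completion V →L[ℂ] Completion V, T.IsPositive ∧ ‖T‖ ≤ 1 ∧
      ∀ v u : V, (inner ℂ (v : Completion V) (T u) : ℂ) = q v u := by
  have hb : ∀ v u, ‖q v u‖ ≤ 1 * ‖v‖ * ‖u‖ := fun v u => by
    simpa using norm_form_le q hq hq1 v u
  set B := extend₂ (q.mkContinuous₂ 1 hb) with hB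
  have hBc : ∀ v u : V, B (v : Completion V) (u : Completion V) = q v u := fun v u => by
    rw [hB, extend₂_coe]; rfl
  -- The Riesz representation puts `T` in the first slot; the symmetry of the positive operator `T`
  -- moves it to the second at the end.
  set T := InnerProductSpace.continuousLinearMapOfBilin B
  have hT : ∀ v u, (inner ℂ (T v) u : ℂ) = B v u :=
    InnerProductSpace.continuousLinearMapOfBilin_apply B
  have hpos : T.IsPositive := by
    rw [ContinuousLinearMap.isPositive_iff_complex]
    have key : ∀ x, (0 : ℂ) ≤ inner ℂ (T x) x := by
      intro x
      induction x using Completion.induction_on with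
      | hp => exact isClosed_le continuous_const (by fun_prop)
      | ih u => rw [hT, hBc]; exact hq u
    intro x
    obtain ⟨h1, h2⟩ := Complex.nonneg_iff.1 (key x)
    exact ⟨Complex.ext (by simp) (by simpa using h2), h1⟩
  refine ⟨T, hpos, ?_, fun v u => ?_⟩
  · refine T.opNorm_le_bound zero_le_one fun x => ?_
    have key : ∀ x y, ‖(inner ℂ (T x) y : ℂ)‖ ≤ ‖x‖ * ‖y‖ := by
      intro x y
      induction x, y using Completion.induction_on₂ with
      | hp => exact isClosed_le (by fun_prop) (by fun_prop)
      | ih v u =>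
        rw [hT, hBc, Completion.norm_coe, Completion.norm_coe]
        exact norm_form_le q hq hq1 v u
    have h := key x (T x)
    rw [inner_self_eq_norm_sq_to_K] at h
    rcases (norm_nonneg (T x)).eq_or_lt with h0 | h0
    · rw [← h0]; positivity
    · have : ‖T x‖ * ‖T x‖ ≤ ‖x‖ * ‖T x‖ := by simpa [sq] using h
      simpa using le_of_mul_le_mul_right this h0
  · have := hpos.isSymmetric (v : Completion V) (u : Completion V)
    rw [← hBc, ← hT]
    exact this.symm

end Completion

section Form

open UniformSpace

variable {A : Type*} [MeasurableSpace A] {V : Type*} [NormedAddCommGroup V]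
  [InnerProductSpace ℂ V]

lemma QPM.isCA {H : Type*} [NormedAddCommGroup H] [InnerProductSpace ℂ H] (P : QPM A H)
    (η ξ : H) : IsCA (fun α => (inner ℂ η (P.toFun α ξ) : ℂ)) :=
  fun s hs hd => P.hasSum_iUnion s hs hd ξ η

/-- A countably additive family of positive forms normalized by the inner product is implemented
by a quantum probability measure on the completion. -/
lemma exists_qpm_of_form (q : Set A → V →ₗ⋆[ℂ] V →ₗ[ℂ] ℂ)
    (hpos : ∀ L, MeasurableSet L → ∀ u, 0 ≤ q L u u)
    (huniv : ∀ v u, q Set.univ v u = inner ℂ v u)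
    (hCA : ∀ v u, IsCA (fun L => q L v u)) :
    ∃ R : QPM A (Completion V), ∀ L, MeasurableSet L → ∀ v u : V,
      (inner ℂ (v : Completion V) (R.toFun L u) : ℂ) = q L v u := by
  classical
  -- The complement carries the form `1 - q L`, which is nonnegative.
  have hq1 : ∀ L, MeasurableSet L → ∀ u, (q L u u).re ≤ ‖u‖ ^ 2 := by
    intro L hL u
    have h1 := (hCA u u).compl hL
    have h2 := (Complex.nonneg_iff.1 (hpos Lᶜ hL.compl u)).1
    rw [h1, huniv, Complex.sub_re, inner_self_eq_norm_sq_to_K] at h2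
    have h3 : (((‖u‖ : ℝ) : ℂ) ^ 2).re = ‖u‖ ^ 2 := by rw [← Complex.ofReal_pow, Complex.ofReal_re]
    have h4 : ‖u‖ ^ 2 - (q L u u).re ≥ 0 := by rw [← h3]; exact h2
    linarith
  choose T hTpos hTnorm hT using fun (L : {L : Set A // MeasurableSet L}) =>
    exists_op_of_form (q L) (hpos L L.2) (hq1 L L.2)
  have hT_union : ∀ L M : {L : Set A // MeasurableSet L}, Disjoint L.1 M.1 →
      T ⟨L.1 ∪ M.1, L.2.union M.2⟩ = T L + T M := by
    intro L M h
    refine completion_op_ext fun v u => ?_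
    rw [add_apply, inner_add_right, hT, hT, hT]
    exact (hCA v u).union L.2 M.2 h
  have hT_empty : T ⟨∅, .empty⟩ = 0 := by
    refine completion_op_ext fun v u => ?_
    rw [hT]
    simpa using (hCA v u).empty
  let R : QPM A (Completion V) :=
    { toFun := fun L => if hL : MeasurableSet L then T ⟨L, hL⟩ else 0
      isPositive := fun L hL => by
        rw [dif_pos hL]
        exact hTpos _
      apply_univ := by
        rw [dif_pos MeasurableSet.univ]
        refine completion_op_ext fun v u => ?_
        rw [hT, huniv, ContinuousLinearMap.id_apply, Completion.inner_coe]
      hasSum_iUnion := by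
        intro s hs hd ξ η
        simp only [hs, MeasurableSet.iUnion hs, dif_pos]
        -- A partial sum is the operator of one set, hence a contraction. This bound, uniform in
        -- `F`, carries convergence from `V` to its completion.
        have hfin : ∀ F : Finset ℕ, ∃ hF : MeasurableSet (⋃ i ∈ F, s i),
            ∑ i ∈ F, T ⟨s i, hs i⟩ = T ⟨⋃ i ∈ F, s i, hF⟩ := by
          intro F
          refine ⟨Finset.measurableSet_biUnion F fun i _ => hs i, ?_⟩
          induction F using Finset.induction_on with
          | empty => simpa using hT_empty.symm
          | insert a F ha ih =>
            rw [Finset.sum_insert ha, ih]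
            rw [← hT_union]
            · congr 2
              simp
            · rw [Set.disjoint_iUnion₂_right]
              intro i hi
              exact hd a i (by rintro rfl; exact ha hi)
        have hnorm : ∀ F : Finset ℕ, ‖∑ i ∈ F, T ⟨s i, hs i⟩‖ ≤ 1 := by
          intro F
          obtain ⟨hF, h⟩ := hfin F
          rw [h]
          exact hTnorm _
        have hsum : ∀ (F : Finset ℕ) (ξ η : Completion V),
            ∑ i ∈ F, (inner ℂ η (T ⟨s i, hs i⟩ ξ) : ℂ)
              = inner ℂ η ((∑ i ∈ F, T ⟨s i, hs i⟩) ξ) := by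
          intro F ξ η
          rw [sum_apply, inner_sum]
        have hle : ∀ (F : Finset ℕ) (ξ η : Completion V),
            ‖(inner ℂ η ((∑ i ∈ F, T ⟨s i, hs i⟩) ξ) : ℂ)‖ ≤ ‖η‖ * ‖ξ‖ := fun F ξ η =>
          (norm_inner_le_norm _ _).trans (mul_le_mul_of_nonneg_left
            ((ContinuousLinearMap.le_of_opNorm_le _ (hnorm F) ξ).trans_eq (one_mul _))
            (norm_nonneg _))
        -- The uniform bound makes the partial sums equicontinuous in each vector, so the vectors at
        -- which they converge to the claimed limit form a closed set. Thus `η`, then `ξ`, may be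
        -- taken in the dense subspace `V`, where `hCA` applies.
        change Filter.Tendsto _ _ _
        simp only [SummationFilter.unconditional_filter, hsum]
        induction η using Completion.induction_on with
        | hp =>
          refine Equicontinuous.isClosed_setOfPred_tendsto ?_ (by fun_prop)
          refine (LipschitzWith.uniformEquicontinuous _ ‖ξ‖₊ fun F => ?_).equicontinuous
          refine LipschitzWith.of_dist_le_mul fun x y => ?_
          rw [dist_eq_norm, dist_eq_norm, ← inner_sub_left, mul_comm]
          exact hle F ξ (x - y)
        | ih v =>
        induction ξ using Completion.induction_on with
        | hp =>
          refine Equicontinuous.isClosed_setOfPred_tendsto ?_ (by fun_prop)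
          refine (LipschitzWith.uniformEquicontinuous _ ‖v‖₊ fun F => ?_).equicontinuous
          refine LipschitzWith.of_dist_le_mul fun x y => ?_
          rw [dist_eq_norm, dist_eq_norm, ← inner_sub_right, ← map_sub]
          simpa using hle F (x - y) v
        | ih u =>
          simp only [← hsum, hT]
          exact hCA v u s hs hd }
  refine ⟨R, fun L hL v u => ?_⟩
  change (inner ℂ (v : Completion V) ((dite _ _ _ : Completion V →L[ℂ] Completion V) u) : ℂ) = _
  rw [dif_pos hL, hT]

end Form

/-! ### Tensor products of quantum probability measures -/

section Tensor

open UniformSpace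

variable {H K : Type*} [NormedAddCommGroup H] [InnerProductSpace ℂ H]
  [NormedAddCommGroup K] [InnerProductSpace ℂ K]

lemma tensorOp_coe (S : H →L[ℂ] H) (T : K →L[ℂ] K) (u : H ⊗[ℂ] K) :
    tensorOp S T (u : HilbertTensor H K) = (TensorProduct.mapL S T u : H ⊗[ℂ] K) :=
  ContinuousLinearMap.completion_apply_coe _ _

lemma tensorOp_mul (S S' : H →L[ℂ] H) (T T' : K →L[ℂ] K) :
    tensorOp (S * S') (T * T') = tensorOp S T * tensorOp S' T' := by
  refine completion_op_ext fun v u => ?_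
  rw [mul_apply_eq_comp, tensorOp_coe, tensorOp_coe, tensorOp_coe,
    TensorProduct.mapL_mul]
  rfl

lemma tensorOp_id : tensorOp (ContinuousLinearMap.id ℂ H) (ContinuousLinearMap.id ℂ K)
    = ContinuousLinearMap.id ℂ (HilbertTensor H K) := by
  refine completion_op_ext fun v u => ?_
  rw [tensorOp_coe, TensorProduct.mapL_id_id]
  rfl

lemma inner_mapL_adjoint [CompleteSpace H] [CompleteSpace K] (S : H →L[ℂ] H) (T : K →L[ℂ] K)
    (v u : H ⊗[ℂ] K) :
    (inner ℂ v (TensorProduct.mapL (star S) (star T) u) : ℂ)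
      = inner ℂ (TensorProduct.mapL S T v) u := by
  induction u with
  | zero => simp
  | add u u' hu hu' => rw [map_add, inner_add_right, inner_add_right, hu, hu']
  | tmul ξ η =>
    induction v with
    | zero => simp
    | add v v' hv hv' => rw [map_add, inner_add_left, inner_add_left, hv, hv']
    | tmul ξ' η' =>
      simp only [TensorProduct.mapL_tmul, TensorProduct.inner_tmul,
        ContinuousLinearMap.star_eq_adjoint, ContinuousLinearMap.adjoint_inner_right]

/-- Factor `S = S'* S'` and `T = T'* T'`. Then `S ⊗ T` is `(S' ⊗ T')* (S' ⊗ T')`, and the form is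
the squared norm of `(S' ⊗ T') u`. -/
lemma inner_mapL_nonneg [CompleteSpace H] [CompleteSpace K] {S : H →L[ℂ] H} {T : K →L[ℂ] K}
    (hS : S.IsPositive) (hT : T.IsPositive) (u : H ⊗[ℂ] K) :
    (0 : ℂ) ≤ inner ℂ u (TensorProduct.mapL S T u) := by
  obtain ⟨S', rfl⟩ := CStarAlgebra.nonneg_iff_eq_star_mul_self.1
    ((ContinuousLinearMap.nonneg_iff_isPositive S).2 hS)
  obtain ⟨T', rfl⟩ := CStarAlgebra.nonneg_iff_eq_star_mul_self.1
    ((ContinuousLinearMap.nonneg_iff_isPositive T).2 hT)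
  rw [TensorProduct.mapL_mul, mul_apply_eq_comp, inner_mapL_adjoint]
  rw [inner_self_eq_norm_sq_to_K]
  exact pow_nonneg (Complex.zero_le_real.2 (norm_nonneg (TensorProduct.mapL S' T' u))) 2

variable {A B : Type*} [MeasurableSpace A] [MeasurableSpace B]

/-- On elementary tensors the coefficient factors, and `IsCA.exists_prod` multiplies the two complex
measures; sums of tensors give sums of set functions. -/
lemma exists_isCA_tensor (P : QPM A H) (Q : QPM B K) (v u : H ⊗[ℂ] K) :
    ∃ f : Set (A × B) → ℂ, IsCA f ∧ ∀ α β, MeasurableSet α → MeasurableSet β →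
      f (α ×ˢ β) = inner ℂ v (TensorProduct.mapL (P.toFun α) (Q.toFun β) u) := by
  induction u with
  | zero => exact ⟨fun _ => 0, IsCA.zero, by simp⟩
  | add u u' hu hu' =>
    obtain ⟨f, hf, hf'⟩ := hu
    obtain ⟨g, hg, hg'⟩ := hu'
    exact ⟨fun L => f L + g L, hf.add hg, fun α β hα hβ => by
      beta_reduce
      rw [hf' α β hα hβ, hg' α β hα hβ, map_add, inner_add_right]⟩
  | tmul ξ η =>
    induction v with
    | zero => exact ⟨fun _ => 0, IsCA.zero, by simp⟩
    | add v v' hv hv' =>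
      obtain ⟨f, hf, hf'⟩ := hv
      obtain ⟨g, hg, hg'⟩ := hv'
      exact ⟨fun L => f L + g L, hf.add hg, fun α β hα hβ => by
        beta_reduce
        rw [hf' α β hα hβ, hg' α β hα hβ, inner_add_left]⟩
    | tmul ξ' η' =>
      obtain ⟨f, hf, hf'⟩ := (P.isCA ξ' ξ).exists_prod (Q.isCA η' η)
      exact ⟨f, hf, fun α β hα hβ => by
        rw [hf' α β hα hβ, TensorProduct.mapL_tmul, TensorProduct.inner_tmul]⟩

lemma exists_tensorQPM [CompleteSpace H] [CompleteSpace K] (P : QPM A H) (Q : QPM B K) :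
    ∃ R : QPM (A × B) (HilbertTensor H K), ∀ α β, MeasurableSet α → MeasurableSet β →
      R.toFun (α ×ˢ β) = tensorOp (P.toFun α) (Q.toFun β) := by
  classical
  choose f hf hf' using exists_isCA_tensor P Q
  -- The functions `f v u` were chosen separately for each pair. Linearity holds because both sides
  -- of each law are countably additive in `L` and agree on rectangles; the value 0 keeps it true on
  -- non-measurable `L`.
  let q : Set (A × B) → (H ⊗[ℂ] K) →ₗ⋆[ℂ] (H ⊗[ℂ] K) →ₗ[ℂ] ℂ := fun L =>
    LinearMap.mk₂'ₛₗ _ _ (fun v u => if MeasurableSet L then f v u L else 0)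
      (fun v v' u => by
        split_ifs with hL
        · refine (hf _ _).ext_prod ((hf _ _).add (hf _ _)) (fun α β hα hβ => ?_) hL
          simp only [hf' _ _ α β hα hβ, inner_add_left]
        · simp)
      (fun c v u => by
        split_ifs with hL
        · refine (hf _ _).ext_prod ((hf _ _).const_mul _) (fun α β hα hβ => ?_) hL
          simp only [hf' _ _ α β hα hβ, inner_smul_left]
        · simp)
      (fun v u u' => by
        split_ifs with hL
        · refine (hf _ _).ext_prod ((hf _ _).add (hf _ _)) (fun α β hα hβ => ?_) hL
          simp only [hf' _ _ α β hα hβ, map_add, inner_add_right]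
        · simp)
      (fun c v u => by
        split_ifs with hL
        · refine (hf _ _).ext_prod ((hf _ _).const_mul _) (fun α β hα hβ => ?_) hL
          simp only [hf' _ _ α β hα hβ, map_smul, RingHom.id_apply]
          exact inner_smul_right v (TensorProduct.mapL (P.toFun α) (Q.toFun β) u) c
        · simp)
  have hq : ∀ L, MeasurableSet L → ∀ v u, q L v u = f v u L := fun L hL v u => if_pos hL
  obtain ⟨R, hR⟩ := exists_qpm_of_form q
    (fun L hL u => by
      rw [hq L hL]
      refine (hf u u).nonneg_of_prod (fun α β hα hβ => ?_) hL
      rw [hf' u u α β hα hβ]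
      exact inner_mapL_nonneg (P.isPositive α hα) (Q.isPositive β hβ) u)
    (fun v u => by
      rw [hq _ .univ, ← Set.univ_prod_univ, hf' v u _ _ .univ .univ, P.apply_univ, Q.apply_univ,
        TensorProduct.mapL_id_id]
      rfl)
    (fun v u => (hf v u).congr fun L hL => hq L hL v u)
  refine ⟨R, fun α β hα hβ => completion_op_ext fun v u => ?_⟩
  rw [hR _ (hα.prod hβ), hq _ (hα.prod hβ), hf' v u α β hα hβ, tensorOp_coe, Completion.inner_coe]

variable {X Y : Type*} [MeasurableSpace X] [MeasurableSpace Y]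

lemma measurable_inner_mapL (E : OpChannel X A H) (F : OpChannel Y B K) {α : Set A} {β : Set B}
    (hα : MeasurableSet α) (hβ : MeasurableSet β) (v u : H ⊗[ℂ] K) :
    Measurable fun z : X × Y => (inner ℂ v
      (TensorProduct.mapL ((E.qpm z.1).toFun α) ((F.qpm z.2).toFun β) u) : ℂ) := by
  induction u with
  | zero => simp
  | add u u' hu hu' =>
    simp only [map_add, inner_add_right]
    exact hu.add hu'
  | tmul ξ η =>
    induction v with
    | zero => simp
    | add v v' hv hv' =>
      simp only [inner_add_left]
      exact hv.add hv'
    | tmul ξ' η' =>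
      simp only [TensorProduct.mapL_tmul, TensorProduct.inner_tmul]
      exact ((E.measurable α hα ξ ξ').comp measurable_fst).mul
        ((F.measurable β hβ η η').comp measurable_snd)

variable [CompleteSpace H] [CompleteSpace K]

/-- The tensor product of quantum probability measures. -/
noncomputable def tensorQPM (P : QPM A H) (Q : QPM B K) : QPM (A × B) (HilbertTensor H K) :=
  (exists_tensorQPM P Q).choose

lemma tensorQPM_prod (P : QPM A H) (Q : QPM B K) {α : Set A} {β : Set B} (hα : MeasurableSet α)
    (hβ : MeasurableSet β) :
    (tensorQPM P Q).toFun (α ×ˢ β) = tensorOp (P.toFun α) (Q.toFun β) :=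
  (exists_tensorQPM P Q).choose_spec α β hα hβ

/-- Approximate both vectors by sequences from `V` independent of `x`; the coefficient is a
pointwise limit of measurable functions. -/
lemma measurable_inner_of_coe {V X : Type*} [NormedAddCommGroup V] [InnerProductSpace ℂ V]
    [MeasurableSpace X] (T : X → Completion V →L[ℂ] Completion V)
    (h : ∀ v u : V, Measurable fun x => (inner ℂ (v : Completion V) (T x u) : ℂ))
    (η ξ : Completion V) : Measurable fun x => (inner ℂ η (T x ξ) : ℂ) := by
  have approx : ∀ ζ : Completion V, ∃ s : ℕ → V,
      Filter.Tendsto (fun n => (s n : Completion V)) Filter.atTop (nhds ζ) := by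
    intro ζ
    obtain ⟨t, ht, htl⟩ := mem_closure_iff_seq_limit.1 (Completion.denseRange_coe (α := V) ζ)
    choose s hs using ht
    exact ⟨s, by simpa only [hs] using htl⟩
  obtain ⟨s, hs⟩ := approx η
  obtain ⟨t, ht⟩ := approx ξ
  exact measurable_of_tendsto_metrizable (fun n => h (s n) (t n)) (tendsto_pi_nhds.2 fun x =>
    hs.inner (((T x).continuous.tendsto ξ).comp ht))

lemma measurable_inner_tensorQPM (E : OpChannel X A H) (F : OpChannel Y B K) {L : Set (A × B)}
    (hL : MeasurableSet L) (ξ η : HilbertTensor H K) :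
    Measurable fun z : X × Y =>
      (inner ℂ η ((tensorQPM (E.qpm z.1) (F.qpm z.2)).toFun L ξ) : ℂ) := by
  refine IsCA.measurable_of_prod
    (f := fun (z : X × Y) L => inner ℂ η ((tensorQPM (E.qpm z.1) (F.qpm z.2)).toFun L ξ))
    (fun z => QPM.isCA _ η ξ) (fun α β hα hβ => ?_) hL
  simp only [tensorQPM_prod _ _ hα hβ]
  refine measurable_inner_of_coe _ (fun v u => ?_) η ξ
  simp only [tensorOp_coe, Completion.inner_coe]
  exact measurable_inner_mapL E F hα hβ v u

/-- The tensor product of operator-valued channels. -/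
noncomputable def tensorChannel (E : OpChannel X A H) (F : OpChannel Y B K) :
    OpChannel (X × Y) (A × B) (HilbertTensor H K) where
  qpm z := tensorQPM (E.qpm z.1) (F.qpm z.2)
  measurable _ hL ξ η := measurable_inner_tensorQPM E F hL ξ η

lemma tensorChannel_prod (E : OpChannel X A H) (F : OpChannel Y B K) (z : X × Y) {α : Set A}
    {β : Set B} (hα : MeasurableSet α) (hβ : MeasurableSet β) :
    ((tensorChannel E F).qpm z).toFun (α ×ˢ β)
      = tensorOp ((E.qpm z.1).toFun α) ((F.qpm z.2).toFun β) :=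
  tensorQPM_prod _ _ hα hβ

end Tensor

/-! ### The middle exchange on Hilbert space tensor products -/

section Exchange

open UniformSpace

variable {H₁ K₁ H₂ K₂ : Type*} [NormedAddCommGroup H₁] [InnerProductSpace ℂ H₁]
  [NormedAddCommGroup K₁] [InnerProductSpace ℂ K₁] [NormedAddCommGroup H₂]
  [InnerProductSpace ℂ H₂] [NormedAddCommGroup K₂] [InnerProductSpace ℂ K₂]

section Algebraic

variable {Z W : Type*} [NormedAddCommGroup Z] [InnerProductSpace ℂ Z]
  [NormedAddCommGroup W] [InnerProductSpace ℂ W]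
  (f : H₁ →ₗ[ℂ] H₂ →ₗ[ℂ] Z) (g : K₁ →ₗ[ℂ] K₂ →ₗ[ℂ] W)

/-- The bilinear map `(h₁ ⊗ k₁, h₂ ⊗ k₂) ↦ f(h₁, h₂) ⊗ g(k₁, k₂)` on algebraic tensors. -/
noncomputable def exchangeAlg : (H₁ ⊗[ℂ] K₁) →ₗ[ℂ] (H₂ ⊗[ℂ] K₂) →ₗ[ℂ] HilbertTensor Z W :=
  (TensorProduct.map₂ f g).compr₂ (Completion.toComplL (𝕜 := ℂ)).toLinearMap

lemma exchangeAlg_tmul (h₁ : H₁) (k₁ : K₁) (h₂ : H₂) (k₂ : K₂) :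
    exchangeAlg f g (h₁ ⊗ₜ k₁) (h₂ ⊗ₜ k₂)
      = ((f h₁ h₂ ⊗ₜ[ℂ] g k₁ k₂ : Z ⊗[ℂ] W) : HilbertTensor Z W) := rfl

variable {f g}

/-- Both sides are additive in each of the four tensors, and on elementary tensors both are the same
product of four inner products. Keeping `f` and `g` abstract lets `Z` and `W` be completed tensor
products while the arguments stay algebraic. -/
lemma inner_exchangeAlg
    (hf : ∀ a b c d, (inner ℂ (f a b) (f c d) : ℂ) = inner ℂ a c * inner ℂ b d)
    (hg : ∀ a b c d, (inner ℂ (g a b) (g c d) : ℂ) = inner ℂ a c * inner ℂ b d)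
    {S₁ : H₁ →L[ℂ] H₁} {T₁ : K₁ →L[ℂ] K₁} {S₂ : H₂ →L[ℂ] H₂} {T₂ : K₂ →L[ℂ] K₂}
    {S : Z →L[ℂ] Z} {T : W →L[ℂ] W} (hS : ∀ a b, S (f a b) = f (S₁ a) (S₂ b))
    (hT : ∀ a b, T (g a b) = g (T₁ a) (T₂ b)) (v₁ u₁ : H₁ ⊗[ℂ] K₁) (v₂ u₂ : H₂ ⊗[ℂ] K₂) :
    (inner ℂ (exchangeAlg f g v₁ v₂) (tensorOp S T (exchangeAlg f g u₁ u₂)) : ℂ)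
      = inner ℂ v₁ (TensorProduct.mapL S₁ T₁ u₁) * inner ℂ v₂ (TensorProduct.mapL S₂ T₂ u₂) := by
  induction u₁ with
  | zero => simp
  | add x y hx hy =>
    simp only [map_add, LinearMap.add_apply, inner_add_right, hx, hy, add_mul]
  | tmul h₁ k₁ =>
  induction u₂ with
  | zero => simp
  | add x y hx hy => simp only [map_add, inner_add_right, hx, hy, mul_add]
  | tmul h₂ k₂ =>
  induction v₁ with
  | zero => simp
  | add x y hx hy =>
    simp only [map_add, LinearMap.add_apply, inner_add_left, hx, hy, add_mul]
  | tmul h₁' k₁' =>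
  induction v₂ with
  | zero => simp
  | add x y hx hy => simp only [map_add, inner_add_left, hx, hy, mul_add]
  | tmul h₂' k₂' =>
  rw [exchangeAlg_tmul, exchangeAlg_tmul, tensorOp_coe, Completion.inner_coe,
    TensorProduct.mapL_tmul, TensorProduct.mapL_tmul, TensorProduct.mapL_tmul,
    TensorProduct.inner_tmul, TensorProduct.inner_tmul, TensorProduct.inner_tmul, hS, hT, hf, hg]
  ring

/-- The case of identity operators; it supplies the bound needed to extend the exchange to the
completions. -/
lemma norm_exchangeAlg
    (hf : ∀ a b c d, (inner ℂ (f a b) (f c d) : ℂ) = inner ℂ a c * inner ℂ b d)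
    (hg : ∀ a b c d, (inner ℂ (g a b) (g c d) : ℂ) = inner ℂ a c * inner ℂ b d)
    (u₁ : H₁ ⊗[ℂ] K₁) (u₂ : H₂ ⊗[ℂ] K₂) : ‖exchangeAlg f g u₁ u₂‖ = ‖u₁‖ * ‖u₂‖ := by
  have h := inner_exchangeAlg hf hg (S₁ := .id ℂ H₁) (T₁ := .id ℂ K₁) (S₂ := .id ℂ H₂)
    (T₂ := .id ℂ K₂) (S := .id ℂ Z) (T := .id ℂ W) (fun _ _ => rfl) (fun _ _ => rfl) u₁ u₁ u₂ u₂
  rw [tensorOp_id, TensorProduct.mapL_id_id, TensorProduct.mapL_id_id,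
    ContinuousLinearMap.id_apply, ContinuousLinearMap.id_apply, ContinuousLinearMap.id_apply,
    inner_self_eq_norm_sq_to_K,
    show inner ℂ u₁ u₁ = ((‖u₁‖ : ℝ) : ℂ) ^ 2 from inner_self_eq_norm_sq_to_K u₁,
    show inner ℂ u₂ u₂ = ((‖u₂‖ : ℝ) : ℂ) ^ 2 from inner_self_eq_norm_sq_to_K u₂] at h
  have h' : ‖exchangeAlg f g u₁ u₂‖ ^ 2 = (‖u₁‖ * ‖u₂‖) ^ 2 := by
    rw [mul_pow]
    apply Complex.ofReal_injective
    push_cast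
    exact h
  exact (sq_eq_sq₀ (norm_nonneg _) (by positivity)).1 h'

end Algebraic

variable (H₁ H₂) in
/-- The canonical bilinear map into the Hilbert space tensor product. -/
noncomputable def tmulMap : H₁ →ₗ[ℂ] H₂ →ₗ[ℂ] HilbertTensor H₁ H₂ :=
  (TensorProduct.mk ℂ H₁ H₂).compr₂ (Completion.toComplL (𝕜 := ℂ)).toLinearMap

lemma inner_tmulMap (a : H₁) (b : H₂) (c : H₁) (d : H₂) :
    (inner ℂ (tmulMap H₁ H₂ a b) (tmulMap H₁ H₂ c d) : ℂ) = inner ℂ a c * inner ℂ b d :=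
  (Completion.inner_coe _ _).trans (TensorProduct.inner_tmul _ _ _ _ _)

lemma tensorOp_tmulMap (S : H₁ →L[ℂ] H₁) (T : H₂ →L[ℂ] H₂) (a : H₁) (b : H₂) :
    tensorOp S T (tmulMap H₁ H₂ a b) = tmulMap H₁ H₂ (S a) (T b) :=
  tensorOp_coe _ _ _

variable (H₁ K₁ H₂ K₂) in
/-- The bilinear map `(h₁ ⊗ k₁, h₂ ⊗ k₂) ↦ (h₁ ⊗ h₂) ⊗ (k₁ ⊗ k₂)` on Hilbert space tensor
products. -/
noncomputable def exchange : HilbertTensor H₁ K₁ →L[ℂ] HilbertTensor H₂ K₂ →L[ℂ]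
    HilbertTensor (HilbertTensor H₁ H₂) (HilbertTensor K₁ K₂) :=
  extend₂ ((exchangeAlg (tmulMap H₁ H₂) (tmulMap K₁ K₂)).mkContinuous₂ 1 fun u₁ u₂ => by
    rw [norm_exchangeAlg inner_tmulMap inner_tmulMap, one_mul])

lemma exchange_coe (u₁ : H₁ ⊗[ℂ] K₁) (u₂ : H₂ ⊗[ℂ] K₂) :
    exchange H₁ K₁ H₂ K₂ u₁ u₂ = exchangeAlg (tmulMap H₁ H₂) (tmulMap K₁ K₂) u₁ u₂ := by
  rw [exchange, extend₂_coe]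
  rfl

/-- This makes the joint state of two independent spatial strategies reproduce the product of their
probabilities, with each player's two spaces grouped together. By density it reduces to
`inner_exchangeAlg`. -/
lemma inner_exchange (S₁ : H₁ →L[ℂ] H₁) (T₁ : K₁ →L[ℂ] K₁) (S₂ : H₂ →L[ℂ] H₂)
    (T₂ : K₂ →L[ℂ] K₂) (ξ₁ : HilbertTensor H₁ K₁) (ξ₂ : HilbertTensor H₂ K₂) :
    (inner ℂ (exchange H₁ K₁ H₂ K₂ ξ₁ ξ₂) (tensorOp (tensorOp S₁ S₂) (tensorOp T₁ T₂)
      (exchange H₁ K₁ H₂ K₂ ξ₁ ξ₂)) : ℂ)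
      = inner ℂ ξ₁ (tensorOp S₁ T₁ ξ₁) * inner ℂ ξ₂ (tensorOp S₂ T₂ ξ₂) := by
  induction ξ₁, ξ₂ using Completion.induction_on₂ with
  | hp => exact isClosed_eq (by fun_prop) (by fun_prop)
  | ih u₁ u₂ =>
    rw [exchange_coe, inner_exchangeAlg inner_tmulMap inner_tmulMap (tensorOp_tmulMap S₁ S₂)
      (tensorOp_tmulMap T₁ T₂), tensorOp_coe, tensorOp_coe, Completion.inner_coe,
      Completion.inner_coe]

lemma norm_exchange (ξ₁ : HilbertTensor H₁ K₁) (ξ₂ : HilbertTensor H₂ K₂) :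
    ‖exchange H₁ K₁ H₂ K₂ ξ₁ ξ₂‖ = ‖ξ₁‖ * ‖ξ₂‖ := by
  induction ξ₁, ξ₂ using Completion.induction_on₂ with
  | hp => exact isClosed_eq (by fun_prop) (by fun_prop)
  | ih u₁ u₂ =>
    rw [exchange_coe, norm_exchangeAlg inner_tmulMap inner_tmulMap, Completion.norm_coe,
      Completion.norm_coe]

end Exchange

/-! ### Local pre- and post-processing of correlations -/

section Processing

variable {X Y A B X' Y' A' B' : Type*} [MeasurableSpace X] [MeasurableSpace Y]
  [MeasurableSpace A] [MeasurableSpace B] [MeasurableSpace X'] [MeasurableSpace Y']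
  [MeasurableSpace A'] [MeasurableSpace B']

/-- The push-forward of a quantum probability measure. -/
def QPM.map {H : Type*} [NormedAddCommGroup H] [InnerProductSpace ℂ H] (P : QPM A H)
    {h : A → A'} (hh : Measurable h) : QPM A' H where
  toFun α := P.toFun (h ⁻¹' α)
  isPositive α hα := P.isPositive _ (hh hα)
  apply_univ := by rw [Set.preimage_univ, P.apply_univ]
  hasSum_iUnion s hs hd ξ η := by
    rw [Set.preimage_iUnion]
    exact P.hasSum_iUnion _ (fun i => hh (hs i)) (fun i j hij => (hd i j hij).preimage h) ξ η

/-- Pre- and post-processing of an operator-valued channel. -/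
def OpChannel.process {H : Type*} [NormedAddCommGroup H] [InnerProductSpace ℂ H]
    (E : OpChannel X A H) {f : X' → X} (hf : Measurable f) {h : A → A'} (hh : Measurable h) :
    OpChannel X' A' H where
  qpm x := (E.qpm (f x)).map hh
  measurable _ hα ξ η := (E.measurable _ (hh hα) ξ η).comp hf

/-- Pre- and post-processing of a kernel by local measurable maps. -/
noncomputable def process (p : Kernel (X × Y) (A × B)) (f : X' → X) (g : Y' → Y) (h : A → A')
    (k : B → B') (hf : Measurable f) (hg : Measurable g) : Kernel (X' × Y') (A' × B') :=
  (p.comap (Prod.map f g) (hf.prodMap hg)).map (Prod.map h k)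

variable {p : Kernel (X × Y) (A × B)} {f : X' → X} {g : Y' → Y} {h : A → A'} {k : B → B'}
  (hf : Measurable f) (hg : Measurable g) (hh : Measurable h) (hk : Measurable k)

include hh hk in
lemma process_apply (z : X' × Y') :
    process p f g h k hf hg z = (p (f z.1, g z.2)).map (Prod.map h k) := by
  rw [process, Kernel.map_apply _ (hh.prodMap hk), Kernel.comap_apply]
  rfl

include hh hk in
-- Each player relabels questions and answers alone, so the Hilbert spaces, the state and the convex
-- weights are kept and only the channels are pulled back and pushed forward.
lemma process_mem_corr (t : CorrType) (hp : p ∈ corr.{w} t X Y A B) :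
    process p f g h k hf hg ∈ corr.{w} t X' Y' A' B' := by
  have hm := hh.prodMap hk
  obtain ⟨hns, ht⟩ := hp
  refine ⟨⟨?_, fun x y y' α hα => ?_, fun x x' y β hβ => ?_⟩, ?_⟩
  · have := hns.markov
    unfold process
    have : IsMarkovKernel (p.comap (Prod.map f g) (hf.prodMap hg)) := inferInstance
    exact Kernel.IsMarkovKernel.map _ hm
  · rw [process_apply hf hg hh hk, process_apply hf hg hh hk,
      Measure.map_apply hm (hα.prod .univ), Measure.map_apply hm (hα.prod .univ)]
    exact hns.left (f x) (g y) (g y') _ (hh hα)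
  · rw [process_apply hf hg hh hk, process_apply hf hg hh hk,
      Measure.map_apply hm (MeasurableSet.univ.prod hβ),
      Measure.map_apply hm (MeasurableSet.univ.prod hβ)]
    exact hns.right (f x) (f x') (g y) _ (hk hβ)
  · cases t with
    | ns => trivial
    | loc =>
      obtain ⟨n, q, r, c, hq, hr, hc, hp⟩ := ht
      refine ⟨n, fun i => ((q i).comap f hf).map h, fun i => ((r i).comap g hg).map k, c,
        fun i => ?_, fun i => ?_, hc, fun x y => ?_⟩
      · have := hq i
        exact Kernel.IsMarkovKernel.map _ hh
      · have := hr i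
        exact Kernel.IsMarkovKernel.map _ hk
      · rw [process_apply hf hg hh hk, hp]
        rw [Measure.map_finset_sum' hm.aemeasurable]
        refine Finset.sum_congr rfl fun i _ => ?_
        have := hq i
        have := hr i
        rw [Kernel.map_apply _ hh, Kernel.map_apply _ hk, Kernel.comap_apply, Kernel.comap_apply,
          Measure.map_smul, Measure.map_prod_map _ _ hh hk]
    | qs =>
      obtain ⟨H, K, _, _, _, _, _, _, E, F, G, ξ, hG, hξ, hp⟩ := ht
      refine ⟨H, K, _, _, ‹_›, _, _, ‹_›, E.process hf hh, F.process hg hk,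
        fun z => (G (f z.1, g z.2)).map hm, ξ, fun x y α β hα hβ => ?_, hξ, fun x y L hL => ?_⟩
      · exact hG (f x) (g y) _ _ (hh hα) (hk hβ)
      · rw [process_apply hf hg hh hk, map_measureReal_apply hm hL]
        exact hp (f x) (g y) _ (hm hL)
    | qc =>
      obtain ⟨H, _, _, _, E, F, G, ξ, hEF, hG, hξ, hp⟩ := ht
      refine ⟨H, _, _, ‹_›, E.process hf hh, F.process hg hk,
        fun z => (G (f z.1, g z.2)).map hm, ξ, fun x y α β hα hβ => ?_,
        fun x y α β hα hβ => ?_, hξ, fun x y L hL => ?_⟩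
      · exact hEF (f x) (g y) _ _ (hh hα) (hk hβ)
      · exact hG (f x) (g y) _ _ (hh hα) (hk hβ)
      · rw [process_apply hf hg hh hk, map_measureReal_apply hm hL]
        exact hp (f x) (g y) _ (hm hL)

end Processing

/-! ### Products of correlations -/

section DotKernel

variable {X₁ Y₁ A₁ B₁ X₂ Y₂ A₂ B₂ : Type*}
  [MeasurableSpace X₁] [MeasurableSpace Y₁] [MeasurableSpace A₁] [MeasurableSpace B₁]
  [MeasurableSpace X₂] [MeasurableSpace Y₂] [MeasurableSpace A₂] [MeasurableSpace B₂]

/-- The product of two correlations. -/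
noncomputable def dotKernel (p₁ : Kernel (X₁ × Y₁) (A₁ × B₁)) (p₂ : Kernel (X₂ × Y₂) (A₂ × B₂)) :
    Kernel ((X₁ × X₂) × (Y₁ × Y₂)) ((A₁ × A₂) × (B₁ × B₂)) :=
  ((p₁.parallelComp p₂).comap shuffle measurable_shuffle).map shuffle

variable {p₁ : Kernel (X₁ × Y₁) (A₁ × B₁)} {p₂ : Kernel (X₂ × Y₂) (A₂ × B₂)}

lemma dotKernel_apply [IsMarkovKernel p₁] [IsMarkovKernel p₂] (z : (X₁ × X₂) × (Y₁ × Y₂)) :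
    dotKernel p₁ p₂ z
      = ((p₁ (z.1.1, z.2.1)).prod (p₂ (z.1.2, z.2.2))).map shuffle := by
  rw [dotKernel, Kernel.map_apply _ measurable_shuffle, Kernel.comap_apply,
    Kernel.parallelComp_apply]
  rfl

lemma shuffle_preimage_prod {A B A' B' : Type*} (α : Set A) (β : Set B) (α' : Set A')
    (β' : Set B') :
    (shuffle : (A × B) × (A' × B') → _) ⁻¹' ((α ×ˢ α') ×ˢ (β ×ˢ β')) = (α ×ˢ β) ×ˢ (α' ×ˢ β') := by
  ext z
  simp only [shuffle, Set.mem_preimage, Set.mem_prod]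
  tauto

lemma dotKernel_real_prod [IsMarkovKernel p₁] [IsMarkovKernel p₂] (x : X₁ × X₂) (y : Y₁ × Y₂)
    {α₁ : Set A₁} {α₂ : Set A₂} {β₁ : Set B₁} {β₂ : Set B₂} (hα₁ : MeasurableSet α₁)
    (hα₂ : MeasurableSet α₂) (hβ₁ : MeasurableSet β₁) (hβ₂ : MeasurableSet β₂) :
    (dotKernel p₁ p₂ (x, y)).real ((α₁ ×ˢ α₂) ×ˢ (β₁ ×ˢ β₂))
      = (p₁ (x.1, y.1)).real (α₁ ×ˢ β₁) * (p₂ (x.2, y.2)).real (α₂ ×ˢ β₂) := by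
  rw [dotKernel_apply, map_measureReal_apply measurable_shuffle
    ((hα₁.prod hα₂).prod (hβ₁.prod hβ₂)), shuffle_preimage_prod, measureReal_prod_prod]

lemma isMarkovKernel_dotKernel [IsMarkovKernel p₁] [IsMarkovKernel p₂] :
    IsMarkovKernel (dotKernel p₁ p₂) :=
  Kernel.IsMarkovKernel.map _ measurable_shuffle

lemma map_fst_map_shuffle {A B A' B' : Type*} [MeasurableSpace A] [MeasurableSpace B]
    [MeasurableSpace A'] [MeasurableSpace B'] (μ : Measure (A × B)) (ν : Measure (A' × B'))
    [IsProbabilityMeasure μ] [IsProbabilityMeasure ν] :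
    ((μ.prod ν).map shuffle).map Prod.fst = (μ.map Prod.fst).prod (ν.map Prod.fst) := by
  rw [Measure.map_prod_map _ _ measurable_fst measurable_fst,
    Measure.map_map measurable_fst measurable_shuffle]
  rfl

lemma map_snd_map_shuffle {A B A' B' : Type*} [MeasurableSpace A] [MeasurableSpace B]
    [MeasurableSpace A'] [MeasurableSpace B'] (μ : Measure (A × B)) (ν : Measure (A' × B'))
    [IsProbabilityMeasure μ] [IsProbabilityMeasure ν] :
    ((μ.prod ν).map shuffle).map Prod.snd = (μ.map Prod.snd).prod (ν.map Prod.snd) := by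
  rw [Measure.map_prod_map _ _ measurable_snd measurable_snd,
    Measure.map_map measurable_snd measurable_shuffle]
  rfl

lemma map_fst_apply' {A B : Type*} [MeasurableSpace A] [MeasurableSpace B] (μ : Measure (A × B))
    {α : Set A} (hα : MeasurableSet α) : μ.map Prod.fst α = μ (α ×ˢ Set.univ) := by
  rw [Measure.map_apply measurable_fst hα, Set.prod_univ]

lemma map_snd_apply' {A B : Type*} [MeasurableSpace A] [MeasurableSpace B] (μ : Measure (A × B))
    {β : Set B} (hβ : MeasurableSet β) : μ.map Prod.snd β = μ (Set.univ ×ˢ β) := by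
  rw [Measure.map_apply measurable_snd hβ, Set.univ_prod]

/-- Each player's marginal is the product of the two marginals. Comparing them as measures covers
sets of answer pairs that are not rectangles. -/
lemma IsNS.dot (h₁ : IsNS p₁) (h₂ : IsNS p₂) : IsNS (dotKernel p₁ p₂) := by
  have := h₁.markov
  have := h₂.markov
  refine ⟨isMarkovKernel_dotKernel, fun x y y' α hα => ?_, fun x x' y β hβ => ?_⟩
  · have e₁ : (p₁ (x.1, y.1)).map Prod.fst = (p₁ (x.1, y'.1)).map Prod.fst :=
      Measure.ext fun s hs => by
        rw [map_fst_apply' _ hs, map_fst_apply' _ hs, h₁.left _ _ y'.1 _ hs]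
    have e₂ : (p₂ (x.2, y.2)).map Prod.fst = (p₂ (x.2, y'.2)).map Prod.fst :=
      Measure.ext fun s hs => by
        rw [map_fst_apply' _ hs, map_fst_apply' _ hs, h₂.left _ _ y'.2 _ hs]
    rw [dotKernel_apply, dotKernel_apply, ← map_fst_apply' _ hα, ← map_fst_apply' _ hα,
      map_fst_map_shuffle, map_fst_map_shuffle, e₁, e₂]
  · have e₁ : (p₁ (x.1, y.1)).map Prod.snd = (p₁ (x'.1, y.1)).map Prod.snd :=
      Measure.ext fun s hs => by
        rw [map_snd_apply' _ hs, map_snd_apply' _ hs, h₁.right _ x'.1 _ _ hs]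
    have e₂ : (p₂ (x.2, y.2)).map Prod.snd = (p₂ (x'.2, y.2)).map Prod.snd :=
      Measure.ext fun s hs => by
        rw [map_snd_apply' _ hs, map_snd_apply' _ hs, h₂.right _ x'.2 _ _ hs]
    rw [dotKernel_apply, dotKernel_apply, ← map_snd_apply' _ hβ, ← map_snd_apply' _ hβ,
      map_snd_map_shuffle, map_snd_map_shuffle, e₁, e₂]

lemma map_shuffle_prod_prod {A B A' B' : Type*} [MeasurableSpace A] [MeasurableSpace B]
    [MeasurableSpace A'] [MeasurableSpace B'] (μ : Measure A) (ν : Measure B) (μ' : Measure A')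
    (ν' : Measure B') [IsFiniteMeasure μ] [IsFiniteMeasure ν] [IsFiniteMeasure μ']
    [IsFiniteMeasure ν'] :
    ((μ.prod ν).prod (μ'.prod ν')).map shuffle = (μ.prod μ').prod (ν.prod ν') := by
  symm
  refine Measure.prod_eq_generateFrom generateFrom_prod generateFrom_prod isPiSystem_prod
    isPiSystem_prod
    ⟨fun _ => Set.univ, fun _ => ⟨Set.univ, .univ, Set.univ, .univ, Set.univ_prod_univ⟩,
      fun _ => measure_lt_top _ _, Set.iUnion_const _⟩
    ⟨fun _ => Set.univ, fun _ => ⟨Set.univ, .univ, Set.univ, .univ, Set.univ_prod_univ⟩,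
      fun _ => measure_lt_top _ _, Set.iUnion_const _⟩ ?_
  rintro _ ⟨α, hα, α', hα', rfl⟩ _ ⟨β, hβ, β', hβ', rfl⟩
  rw [Measure.map_apply measurable_shuffle ((MeasurableSet.prod hα hα').prod
    (MeasurableSet.prod hβ hβ')), shuffle_preimage_prod]
  simp only [Measure.prod_prod]
  ring

/-- Multiply out the two convex combinations: the terms are indexed by pairs, with weights `c i * c'
j`, and regroup into one product channel per player. -/
lemma IsLocal.dot [IsMarkovKernel p₁] [IsMarkovKernel p₂] (h₁ : IsLocal p₁) (h₂ : IsLocal p₂) :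
    IsLocal (dotKernel p₁ p₂) := by
  obtain ⟨n, q, r, c, hq, hr, hc, hp⟩ := h₁
  obtain ⟨n', q', r', c', hq', hr', hc', hp'⟩ := h₂
  refine ⟨n * n', fun i => (q (finProdFinEquiv.symm i).1).parallelComp
    (q' (finProdFinEquiv.symm i).2), fun i => (r (finProdFinEquiv.symm i).1).parallelComp
    (r' (finProdFinEquiv.symm i).2), fun i => c (finProdFinEquiv.symm i).1 *
    c' (finProdFinEquiv.symm i).2, fun i => ?_, fun i => ?_, ?_, fun x y => ?_⟩
  · have := hq (finProdFinEquiv.symm i).1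
    have := hq' (finProdFinEquiv.symm i).2
    infer_instance
  · have := hr (finProdFinEquiv.symm i).1
    have := hr' (finProdFinEquiv.symm i).2
    infer_instance
  · rw [finProdFinEquiv.symm.sum_comp fun i : Fin n × Fin n' => c i.1 * c' i.2,
      Fintype.sum_prod_type, ← Finset.sum_mul_sum, hc, hc', one_mul]
  · rw [finProdFinEquiv.symm.sum_comp fun i : Fin n × Fin n' => (c i.1 * c' i.2) •
      (((q i.1).parallelComp (q' i.2)) x).prod (((r i.1).parallelComp (r' i.2)) y)]
    have e : ∀ i : Fin n × Fin n', (((q i.1).parallelComp (q' i.2)) x).prod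
        (((r i.1).parallelComp (r' i.2)) y) =
        (((q i.1 x.1).prod (r i.1 y.1)).prod ((q' i.2 x.2).prod (r' i.2 y.2))).map shuffle := by
      intro i
      have := hq i.1
      have := hr i.1
      have := hq' i.2
      have := hr' i.2
      rw [Kernel.parallelComp_apply, Kernel.parallelComp_apply, map_shuffle_prod_prod]
    simp only [e]
    rw [dotKernel_apply, hp, hp']
    have hfin : ∀ i, IsFiniteMeasure (c i • (q i x.1).prod (r i y.1)) := fun i => by
      have := hq i; have := hr i; infer_instance
    have hfin' : ∀ i, IsFiniteMeasure (c' i • (q' i x.2).prod (r' i y.2)) := fun i => by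
      have := hq' i; have := hr' i; infer_instance
    have hprod : (∑ i, c i • (q i x.1).prod (r i y.1)).prod
        (∑ i, c' i • (q' i x.2).prod (r' i y.2)) = ∑ i : Fin n × Fin n', (c i.1 * c' i.2) •
          ((q i.1 x.1).prod (r i.1 y.1)).prod ((q' i.2 x.2).prod (r' i.2 y.2)) := by
      refine Measure.prod_eq fun s t hs ht => ?_
      simp only [Measure.finsetSum_apply, Measure.smul_apply, Fintype.sum_prod_type,
        Finset.sum_mul_sum]
      refine Finset.sum_congr rfl fun i _ => Finset.sum_congr rfl fun j _ => ?_
      have := hq i; have := hr i; have := hq' j; have := hr' j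
      rw [Measure.prod_prod]
      simp only [ENNReal.smul_def, smul_eq_mul, ENNReal.coe_mul]
      ring
    rw [hprod]
    rw [Measure.map_finset_sum' measurable_shuffle.aemeasurable]
    simp only [Measure.map_smul]

/-- The players hold `H₁ ⊗ H₂` and `K₁ ⊗ K₂` and share the exchanged state; both correlations are
countably additive, so rectangles suffice. -/
lemma IsQuantumSpatial.dot [IsMarkovKernel p₁] [IsMarkovKernel p₂]
    (h₁ : IsQuantumSpatial.{w} p₁) (h₂ : IsQuantumSpatial.{w} p₂) :
    IsQuantumSpatial.{w} (dotKernel p₁ p₂) := by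
  obtain ⟨H₁, K₁, _, _, _, _, _, _, E₁, F₁, G₁, ξ₁, hG₁, hξ₁, hp₁⟩ := h₁
  obtain ⟨H₂, K₂, _, _, _, _, _, _, E₂, F₂, G₂, ξ₂, hG₂, hξ₂, hp₂⟩ := h₂
  have := isMarkovKernel_dotKernel (p₁ := p₁) (p₂ := p₂)
  refine ⟨HilbertTensor H₁ H₂, HilbertTensor K₁ K₂, inferInstance, inferInstance, inferInstance,
    inferInstance, inferInstance, inferInstance, tensorChannel E₁ E₂, tensorChannel F₁ F₂,
    fun z => tensorQPM ((tensorChannel E₁ E₂).qpm z.1) ((tensorChannel F₁ F₂).qpm z.2),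
    exchange H₁ K₁ H₂ K₂ ξ₁ ξ₂, fun x y α β hα hβ => tensorQPM_prod _ _ hα hβ, ?_,
    fun x y L hL => ?_⟩
  · rw [norm_exchange, hξ₁, hξ₂, one_mul]
  · refine (IsCA.measure _).ext_prod_prod (QPM.isCA _ _ _)
      (fun α₁ α₂ β₁ β₂ hα₁ hα₂ hβ₁ hβ₂ => ?_) hL
    rw [dotKernel_real_prod _ _ hα₁ hα₂ hβ₁ hβ₂, tensorQPM_prod _ _ (hα₁.prod hα₂) (hβ₁.prod hβ₂),
      tensorChannel_prod _ _ _ hα₁ hα₂, tensorChannel_prod _ _ _ hβ₁ hβ₂, inner_exchange,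
      Complex.ofReal_mul, hp₁ _ _ _ (hα₁.prod hβ₁), hp₂ _ _ _ (hα₂.prod hβ₂),
      hG₁ _ _ _ _ hα₁ hβ₁, hG₂ _ _ _ _ hα₂ hβ₂]

lemma IsQuantumCommuting.dot [IsMarkovKernel p₁] [IsMarkovKernel p₂]
    (h₁ : IsQuantumCommuting.{w} p₁) (h₂ : IsQuantumCommuting.{w} p₂) :
    IsQuantumCommuting.{w} (dotKernel p₁ p₂) := by
  obtain ⟨H₁, _, _, _, E₁, F₁, G₁, ξ₁, hEF₁, hG₁, hξ₁, hp₁⟩ := h₁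
  obtain ⟨H₂, _, _, _, E₂, F₂, G₂, ξ₂, hEF₂, hG₂, hξ₂, hp₂⟩ := h₂
  have := isMarkovKernel_dotKernel (p₁ := p₁) (p₂ := p₂)
  -- Tensoring the given joint measures `G₁` and `G₂` gives positivity and countable additivity at
  -- once; only the product formula is left to check.
  let G : (X₁ × X₂) × (Y₁ × Y₂) → QPM ((A₁ × A₂) × (B₁ × B₂)) (HilbertTensor H₁ H₂) := fun z =>
    (tensorQPM (G₁ (z.1.1, z.2.1)) (G₂ (z.1.2, z.2.2))).map measurable_shuffle
  have hGr : ∀ z {α₁ : Set A₁} {α₂ : Set A₂} {β₁ : Set B₁} {β₂ : Set B₂}, MeasurableSet α₁ →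
      MeasurableSet α₂ → MeasurableSet β₁ → MeasurableSet β₂ →
      (G z).toFun ((α₁ ×ˢ α₂) ×ˢ (β₁ ×ˢ β₂)) = tensorOp
        ((G₁ (z.1.1, z.2.1)).toFun (α₁ ×ˢ β₁)) ((G₂ (z.1.2, z.2.2)).toFun (α₂ ×ˢ β₂)) := by
    intro z α₁ α₂ β₁ β₂ hα₁ hα₂ hβ₁ hβ₂
    change (tensorQPM _ _).toFun (shuffle ⁻¹' _) = _
    rw [shuffle_preimage_prod, tensorQPM_prod _ _ (hα₁.prod hβ₁) (hα₂.prod hβ₂)]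
  have hpos : ∀ {α : Set (A₁ × A₂)} (x : X₁ × X₂), MeasurableSet α →
      IsSelfAdjoint (((tensorChannel E₁ E₂).qpm x).toFun α) :=
    fun x hα => (((tensorChannel E₁ E₂).qpm x).isPositive _ hα).isSelfAdjoint
  have hpos' : ∀ {β : Set (B₁ × B₂)} (y : Y₁ × Y₂), MeasurableSet β →
      IsSelfAdjoint (((tensorChannel F₁ F₂).qpm y).toFun β) :=
    fun y hβ => (((tensorChannel F₁ F₂).qpm y).isPositive _ hβ).isSelfAdjoint
  have hprod : IsCommutingProduct (tensorChannel E₁ E₂) (tensorChannel F₁ F₂) G := by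
    intro x y α β hα hβ
    ext ξ
    refine ext_inner_left ℂ fun η => ?_
    rw [mul_apply_eq_comp]
    refine ((QPM.isCA _ η ξ).prod_left hβ).ext_prod (QPM.isCA _ η _) (fun α₁ α₂ hα₁ hα₂ => ?_) hα
    -- Moving the self-adjoint operator to the left vector displays the expression as a coefficient
    -- of the second player's measure, hence countably additive in `β`.
    have e : ∀ β : Set (B₁ × B₂), (inner ℂ η (((tensorChannel E₁ E₂).qpm x).toFun (α₁ ×ˢ α₂)
        (((tensorChannel F₁ F₂).qpm y).toFun β ξ)) : ℂ) = inner ℂ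
        (((tensorChannel E₁ E₂).qpm x).toFun (α₁ ×ˢ α₂) η)
        (((tensorChannel F₁ F₂).qpm y).toFun β ξ) := fun β => by
      exact ((((tensorChannel E₁ E₂).qpm x).isPositive _ (hα₁.prod hα₂)).isSymmetric _ _).symm
    rw [e]
    refine ((QPM.isCA _ η ξ).prod_right (hα₁.prod hα₂)).ext_prod (QPM.isCA _ _ ξ)
      (fun β₁ β₂ hβ₁ hβ₂ => ?_) hβ
    rw [← e, hGr _ hα₁ hα₂ hβ₁ hβ₂, hG₁ _ _ _ _ hα₁ hβ₁, hG₂ _ _ _ _ hα₂ hβ₂, tensorOp_mul,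
      tensorChannel_prod _ _ _ hα₁ hα₂, tensorChannel_prod _ _ _ hβ₁ hβ₂]
    rfl
  refine ⟨HilbertTensor H₁ H₂, inferInstance, inferInstance, inferInstance, tensorChannel E₁ E₂,
    tensorChannel F₁ F₂, G, tmulMap H₁ H₂ ξ₁ ξ₂, fun x y α β hα hβ => ?_, hprod, ?_,
    fun x y L hL => ?_⟩
  -- Self-adjoint operators commute exactly when their product is self-adjoint, and here the product
  -- is the positive operator `G (x, y)` at `α ×ˢ β`.
  · rw [(hpos x hα).commute_iff (hpos' y hβ), ← hprod x y α β hα hβ]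
    exact ((G (x, y)).isPositive _ (hα.prod hβ)).isSelfAdjoint
  · have h := inner_tmulMap ξ₁ ξ₂ ξ₁ ξ₂
    rw [inner_self_eq_norm_sq_to_K, inner_self_eq_norm_sq_to_K, inner_self_eq_norm_sq_to_K, hξ₁,
      hξ₂] at h
    have h' : ‖tmulMap H₁ H₂ ξ₁ ξ₂‖ ^ 2 = 1 := by
      apply Complex.ofReal_injective
      push_cast
      simpa using h
    exact (pow_eq_one_iff_of_nonneg (norm_nonneg _) two_ne_zero).1 h'
  · refine (IsCA.measure _).ext_prod_prod (QPM.isCA _ _ _)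
      (fun α₁ α₂ β₁ β₂ hα₁ hα₂ hβ₁ hβ₂ => ?_) hL
    rw [dotKernel_real_prod _ _ hα₁ hα₂ hβ₁ hβ₂, hGr _ hα₁ hα₂ hβ₁ hβ₂, tensorOp_tmulMap,
      inner_tmulMap, Complex.ofReal_mul, hp₁ _ _ _ (hα₁.prod hβ₁), hp₂ _ _ _ (hα₂.prod hβ₂)]

/-- Each correlation type is closed under products. -/
lemma dotKernel_mem_corr (t : CorrType) (h₁ : p₁ ∈ corr.{w} t X₁ Y₁ A₁ B₁)
    (h₂ : p₂ ∈ corr.{w} t X₂ Y₂ A₂ B₂) :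
    dotKernel p₁ p₂ ∈ corr.{w} t (X₁ × X₂) (Y₁ × Y₂) (A₁ × A₂) (B₁ × B₂) := by
  have := h₁.1.markov
  have := h₂.1.markov
  refine ⟨h₁.1.dot h₂.1, ?_⟩
  cases t with
  | loc => exact IsLocal.dot h₁.2 h₂.2
  | qs => exact IsQuantumSpatial.dot h₁.2 h₂.2
  | qc => exact IsQuantumCommuting.dot h₁.2 h₂.2
  | ns => trivial

end DotKernel

/-! ### Values of product games -/

section Values

variable {X₁ Y₁ A₁ B₁ X₂ Y₂ A₂ B₂ : Type*}
  [MeasurableSpace X₁] [MeasurableSpace Y₁] [MeasurableSpace A₁] [MeasurableSpace B₁]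
  [MeasurableSpace X₂] [MeasurableSpace Y₂] [MeasurableSpace A₂] [MeasurableSpace B₂]
  {κ₁ : Set ((X₁ × Y₁) × (A₁ × B₁))} {κ₂ : Set ((X₂ × Y₂) × (A₂ × B₂))}
  {π₁ : Measure (X₁ × Y₁)} {π₂ : Measure (X₂ × Y₂)}

lemma measurableSet_dotSet (h₁ : MeasurableSet κ₁) (h₂ : MeasurableSet κ₂) :
    MeasurableSet (dotSet κ₁ κ₂) :=
  (h₁.preimage (f := fun z : ((X₁ × X₂) × (Y₁ × Y₂)) × ((A₁ × A₂) × (B₁ × B₂)) =>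
      ((z.1.1.1, z.1.2.1), (z.2.1.1, z.2.2.1))) (by fun_prop)).inter
    (h₂.preimage (f := fun z : ((X₁ × X₂) × (Y₁ × Y₂)) × ((A₁ × A₂) × (B₁ × B₂)) =>
      ((z.1.1.2, z.1.2.2), (z.2.1.2, z.2.2.2))) (by fun_prop))

/-- The winning probability in a product of games, as an integral over pairs of questions. -/
lemma compProd_dotSet [IsProbabilityMeasure π₁] [IsProbabilityMeasure π₂]
    (p : Kernel ((X₁ × X₂) × (Y₁ × Y₂)) ((A₁ × A₂) × (B₁ × B₂))) [IsMarkovKernel p]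
    (h₁ : MeasurableSet κ₁) (h₂ : MeasurableSet κ₂) :
    (dotMeasure π₁ π₂ ⊗ₘ p) (dotSet κ₁ κ₂) = ∫⁻ z, p (shuffle z)
      (Prod.mk (shuffle z) ⁻¹' dotSet κ₁ κ₂) ∂(π₁.prod π₂) := by
  have hS := measurableSet_dotSet h₁ h₂
  have : IsProbabilityMeasure (dotMeasure π₁ π₂) :=
    Measure.isProbabilityMeasure_map measurable_shuffle.aemeasurable
  rw [Measure.compProd_apply hS, dotMeasure,
    lintegral_map (Kernel.measurable_kernel_prodMk_left hS) measurable_shuffle]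

/-- The winning probability of a product strategy in a product game. -/
lemma compProd_dotKernel_dotSet [IsProbabilityMeasure π₁] [IsProbabilityMeasure π₂]
    (p₁ : Kernel (X₁ × Y₁) (A₁ × B₁)) (p₂ : Kernel (X₂ × Y₂) (A₂ × B₂)) [IsMarkovKernel p₁]
    [IsMarkovKernel p₂] (h₁ : MeasurableSet κ₁) (h₂ : MeasurableSet κ₂) :
    (dotMeasure π₁ π₂ ⊗ₘ dotKernel p₁ p₂) (dotSet κ₁ κ₂)
      = (π₁ ⊗ₘ p₁) κ₁ * (π₂ ⊗ₘ p₂) κ₂ := by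
  have := isMarkovKernel_dotKernel (p₁ := p₁) (p₂ := p₂)
  rw [compProd_dotSet _ h₁ h₂, Measure.compProd_apply h₁, Measure.compProd_apply h₂,
    ← lintegral_prod_mul (Kernel.measurable_kernel_prodMk_left h₁).aemeasurable
      (Kernel.measurable_kernel_prodMk_left h₂).aemeasurable]
  refine lintegral_congr fun z => ?_
  rw [dotKernel_apply, Measure.map_apply measurable_shuffle
    (measurable_prodMk_left (measurableSet_dotSet h₁ h₂)), ← Measure.prod_prod]
  rfl

/-- Integrating out the questions of a trivially won second game. -/
lemma compProd_dotSet_univ [IsProbabilityMeasure π₁] [IsProbabilityMeasure π₂]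
    (p : Kernel ((X₁ × X₂) × (Y₁ × Y₂)) ((A₁ × A₂) × (B₁ × B₂))) [IsMarkovKernel p]
    (h₁ : MeasurableSet κ₁) :
    (dotMeasure π₁ π₂ ⊗ₘ p) (dotSet κ₁ Set.univ) = ∫⁻ z₂, (π₁ ⊗ₘ process p
      (fun x₁ => (x₁, z₂.1)) (fun y₁ => (y₁, z₂.2)) (Prod.fst : A₁ × A₂ → A₁)
      (Prod.fst : B₁ × B₂ → B₁) measurable_prodMk_right measurable_prodMk_right) κ₁ ∂π₂ := by
  have hS : MeasurableSet (dotSet κ₁ (Set.univ : Set ((X₂ × Y₂) × (A₂ × B₂)))) :=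
    measurableSet_dotSet h₁ .univ
  -- The second pair of questions goes outside: for each fixed value the inner integral is the score
  -- of one strategy for the first game.
  rw [compProd_dotSet p h₁ .univ, lintegral_prod_symm' (f := fun z => p (shuffle z)
      (Prod.mk (shuffle z) ⁻¹' dotSet κ₁ (Set.univ : Set ((X₂ × Y₂) × (A₂ × B₂)))))
    ((Kernel.measurable_kernel_prodMk_left hS).comp measurable_shuffle)]
  refine lintegral_congr fun z₂ => ?_
  have : IsMarkovKernel (process p (fun x₁ => (x₁, z₂.1)) (fun y₁ => (y₁, z₂.2))
      (Prod.fst : A₁ × A₂ → A₁) (Prod.fst : B₁ × B₂ → B₁) measurable_prodMk_right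
      measurable_prodMk_right) :=
    Kernel.IsMarkovKernel.map _ (measurable_fst.prodMap measurable_fst)
  rw [Measure.compProd_apply h₁]
  refine lintegral_congr fun z₁ => ?_
  rw [process_apply _ _ measurable_fst measurable_fst,
    Measure.map_apply (measurable_fst.prodMap measurable_fst) (measurable_prodMk_left h₁)]
  congr 1
  ext w
  simp only [dotSet, shuffle, Set.mem_univ, and_true]
  rfl

variable (t : CorrType)

/-- Multiplication distributes over suprema in `ℝ≥0∞`, empty ones included, so it is enough to test
pairs of strategies. -/
lemma resourceValue_dot_ge [IsProbabilityMeasure π₁] [IsProbabilityMeasure π₂]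
    (h₁ : MeasurableSet κ₁) (h₂ : MeasurableSet κ₂) :
    resourceValue (corr.{w} t X₁ Y₁ A₁ B₁) κ₁ π₁ * resourceValue (corr.{w} t X₂ Y₂ A₂ B₂) κ₂ π₂ ≤
      resourceValue (corr.{w} t (X₁ × X₂) (Y₁ × Y₂) (A₁ × A₂) (B₁ × B₂)) (dotSet κ₁ κ₂)
        (dotMeasure π₁ π₂) := by
  simp only [resourceValue, ENNReal.iSup_mul, ENNReal.mul_iSup]
  refine iSup₂_le fun p₂ hp₂ => iSup₂_le fun p₁ hp₁ => ?_
  have := hp₁.1.markov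
  have := hp₂.1.markov
  rw [← compProd_dotKernel_dotSet p₁ p₂ h₁ h₂]
  exact le_iSup₂ (f := fun p (_ : p ∈ corr.{w} t (X₁ × X₂) (Y₁ × Y₂) (A₁ × A₂) (B₁ × B₂)) =>
    (dotMeasure π₁ π₂ ⊗ₘ p) (dotSet κ₁ κ₂)) _ (dotKernel_mem_corr t hp₁ hp₂)

/-- For `≤`, an average over `π₂` of scores in the first game is at most their supremum. For `≥`,
ignore the second questions and always answer `a₂`, `b₂`. -/
lemma resourceValue_dot_univ [IsProbabilityMeasure π₁] [IsProbabilityMeasure π₂]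
    (h₁ : MeasurableSet κ₁) (a₂ : A₂) (b₂ : B₂) :
    resourceValue (corr.{w} t (X₁ × X₂) (Y₁ × Y₂) (A₁ × A₂) (B₁ × B₂)) (dotSet κ₁ Set.univ)
      (dotMeasure π₁ π₂) = resourceValue (corr.{w} t X₁ Y₁ A₁ B₁) κ₁ π₁ := by
  refine le_antisymm (iSup₂_le fun p hp => ?_) (iSup₂_le fun p hp => ?_)
  · have := hp.1.markov
    rw [compProd_dotSet_univ p h₁]
    calc _ ≤ ∫⁻ _, resourceValue (corr.{w} t X₁ Y₁ A₁ B₁) κ₁ π₁ ∂π₂ :=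
          lintegral_mono fun z₂ => le_iSup₂ (f := fun p (_ : p ∈ corr.{w} t X₁ Y₁ A₁ B₁) =>
            (π₁ ⊗ₘ p) κ₁) _ (process_mem_corr _ _ measurable_fst measurable_fst t hp)
      _ = _ := by simp
  · have hmem : process p (Prod.fst : X₁ × X₂ → X₁) (Prod.fst : Y₁ × Y₂ → Y₁)
        (fun a => (a, a₂)) (fun b => (b, b₂)) measurable_fst measurable_fst ∈
        corr.{w} t (X₁ × X₂) (Y₁ × Y₂) (A₁ × A₂) (B₁ × B₂) :=
      process_mem_corr _ _ measurable_prodMk_right measurable_prodMk_right t hp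
    have := hp.1.markov
    have := hmem.1.markov
    refine le_trans (le_of_eq ?_) (le_iSup₂
      (f := fun p (_ : p ∈ corr.{w} t (X₁ × X₂) (Y₁ × Y₂) (A₁ × A₂) (B₁ × B₂)) =>
        (dotMeasure π₁ π₂ ⊗ₘ p) (dotSet κ₁ Set.univ)) _ hmem)
    rw [compProd_dotSet_univ _ h₁]
    -- Appending constant answers and then discarding them returns `p`, whatever the second
    -- questions, so the integrand is constant.
    have e : ∀ z₂ : X₂ × Y₂, process (process p (Prod.fst : X₁ × X₂ → X₁)
        (Prod.fst : Y₁ × Y₂ → Y₁) (fun a => (a, a₂)) (fun b => (b, b₂)) measurable_fst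
        measurable_fst) (fun x₁ => (x₁, z₂.1)) (fun y₁ => (y₁, z₂.2)) (Prod.fst : A₁ × A₂ → A₁)
        (Prod.fst : B₁ × B₂ → B₁) measurable_prodMk_right measurable_prodMk_right = p := by
      intro z₂
      ext1 z
      rw [process_apply _ _ measurable_fst measurable_fst,
        process_apply _ _ measurable_prodMk_right measurable_prodMk_right,
        Measure.map_map (measurable_fst.prodMap measurable_fst)
          (measurable_prodMk_right.prodMap measurable_prodMk_right)]
      exact Measure.map_id
    simp only [e, lintegral_const, measure_univ, mul_one]

end Values

end MeasGame

theorem proposition6p3 {X₁ Y₁ A₁ B₁ X₂ Y₂ A₂ B₂ : Type*}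
    [TopologicalSpace X₁] [CompactSpace X₁] [T2Space X₁] [SecondCountableTopology X₁]
    [MeasurableSpace X₁] [BorelSpace X₁]
    [TopologicalSpace Y₁] [CompactSpace Y₁] [T2Space Y₁] [SecondCountableTopology Y₁]
    [MeasurableSpace Y₁] [BorelSpace Y₁]
    [TopologicalSpace A₁] [CompactSpace A₁] [T2Space A₁] [SecondCountableTopology A₁]
    [MeasurableSpace A₁] [BorelSpace A₁]
    [TopologicalSpace B₁] [CompactSpace B₁] [T2Space B₁] [SecondCountableTopology B₁]
    [MeasurableSpace B₁] [BorelSpace B₁]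
    [TopologicalSpace X₂] [CompactSpace X₂] [T2Space X₂] [SecondCountableTopology X₂]
    [MeasurableSpace X₂] [BorelSpace X₂]
    [TopologicalSpace Y₂] [CompactSpace Y₂] [T2Space Y₂] [SecondCountableTopology Y₂]
    [MeasurableSpace Y₂] [BorelSpace Y₂]
    [TopologicalSpace A₂] [CompactSpace A₂] [T2Space A₂] [SecondCountableTopology A₂]
    [MeasurableSpace A₂] [BorelSpace A₂]
    [TopologicalSpace B₂] [CompactSpace B₂] [T2Space B₂] [SecondCountableTopology B₂]
    [MeasurableSpace B₂] [BorelSpace B₂]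
    (TX₁ : X₁ ≃ₜ X₁) (TY₁ : Y₁ ≃ₜ Y₁) (TX₂ : X₂ ≃ₜ X₂) (TY₂ : Y₂ ≃ₜ Y₂)
    (G₁ : MeasGame.MeasurableGame TX₁ TY₁ A₁ B₁) (G₂ : MeasGame.MeasurableGame TX₂ TY₂ A₂ B₂)
    (t : MeasGame.CorrType) :
    (G₁.dot G₂).value.{w} t ≥ G₁.value.{w} t * G₂.value.{w} t ∧
    (Nonempty A₂ → Nonempty B₂ → G₂.κ = Set.univ →
      (G₁.dot G₂).value.{w} t = G₁.value.{w} t) := by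

  have := G₁.isProbabilityMeasure
  have := G₂.isProbabilityMeasure
  refine ⟨MeasGame.resourceValue_dot_ge t G₁.measurableSet_κ G₂.measurableSet_κ, ?_⟩
  rintro ⟨a₂⟩ ⟨b₂⟩ hκ
  change MeasGame.resourceValue _ (MeasGame.dotSet G₁.κ G₂.κ) (MeasGame.dotMeasure G₁.π G₂.π) = _
  rw [hκ]
  exact MeasGame.resourceValue_dot_univ t G₁.measurableSet_κ a₂ b₂
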